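/- For strings $T,R$ over an alphabet $\Sigma$, the relative Lempel--Ziv factorization $\mathsf{rlz}(T,R)$ is the factorization $T=f_1f_2\cdots f_k$ in which every $f_i$ is either a symbol that does not occur in $R$, or the longest nonempty substring of $R$ that is a prefix of $f_if_{i+1}\cdots f_k$; $|\mathsf{rlz}(T,R)|=k$. An $R$-factorization of $T$ is a factorization of $T$ into nonempty phrases each of which is a single symbol or a substring of $R$. Model. Consider a word RAM with word-width $w$ with $m<2^w$ and $w\le C\log_2 m$, whose memory consists of $w$-bit words. Each of the following takes one unit of time: an operation on two words (any binary operation on words is allowed), a direct or indirect memory access, a (conditional) jump, reading one symbol of the read-only reference $R$ at an arbitrary position, reading the next symbol of the streamed text $T$ (or detecting its end), and outputting the next phrase. The output is write-only and consists of the phrases in left-to-right order; each phrase is given as a fragment of $T$ (by its length, as it starts where the previous phrase ends), without an occurrence in $R$. Symbols are integers from $\{0,\dots,\sigma-1\}$ with $m\le\sigma\le 2^w$. Programs may be non-uniform (depend on all parameters) and have at most $m^C$ instructions. An algorithm first maps $R$ to a data structure of at most $S$ bits by an arbitrary preprocessing without resource bounds, and then processes $T$ by a word RAM program using the data structure and at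 most $S$ bits of additional space, where $S\ge w$ (at least one word). A randomized algorithm is a probability distribution over such deterministic algorithms with the same space bounds. Corollary. For every constant $C$ there are constants $\varepsilon,c>0$ such that the following holds for all positive integers $n,m,z,\phi$ with $100z\phi\le n\le zm$, all $w,\sigma$ as above, and all $S\ge w$ with $S\le\varepsilon\, m/\phi^2$ (that is, $S=o(m/\phi^2)$). Consider a randomized algorithm as above and $t\in\mathbb N$. Assume that, for every reference $R$ of length $m$, with probability at least $1/100$ the algorithm has the following property: for every text $T$ of length $n$ with $|\mathsf{rlz}(T,R)|\in[z,100z\phi]$, the text processing halts within $t$ steps and outputs an $R$-factorization of $T$ of size at most $\phi\cdot|\mathsf{rlz}(T,R)|$. Then $$t\ \ge\ c\cdot\frac{zm}{\phi^2S},$$ i.e., the text processing takes $\Omega(zm/(\phi^2S))$ time in the worst case. -/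

import Mathlib

namespace RLZ

/-! ### Relative Lempel--Ziv factorization -/

section Strings

variable {α : Type} [DecidableEq α]

/-- Length of the longest prefix of `T` that is a substring of `R`. -/
def longestMatch (R T : List α) : ℕ :=
  Nat.findGreatest (fun l => T.take l <:+: R) T.length

/-- The relative Lempel--Ziv factorization of `T` with respect to `R`: every factor is the longest
nonempty prefix of the remaining text that is a substring of `R`, or the next symbol of the text
if this symbol does not occur in `R`. -/
def rlz (R : List α) : List α → List (List α)
  | [] => []
  | c :: T =>
    (c :: T).take (max 1 (longestMatch R (c :: T))) ::
      rlz R ((c :: T).drop (max 1 (longestMatch R (c :: T))))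
termination_by T => T.length
decreasing_by
  simp only [List.length_drop, List.length_cons]
  omega

/-- The list `ls` is the list of phrase lengths, from left to right, of an `R`-factorization of
`T`: the phrases are nonempty fragments that partition `T`, and each of them is a single symbol or
a substring of `R`. -/
def IsRFactorization (R : List α) : List α → List ℕ → Prop
  | T, [] => T = []
  | T, l :: ls =>
    1 ≤ l ∧ l ≤ T.length ∧ (l = 1 ∨ T.take l <:+: R) ∧ IsRFactorization R (T.drop l) ls

end Strings

/-! ### The word RAM with a read-only reference, a streamed text and an output stream -/

/-- Instructions of a word RAM with words of `w` bits. Numerals `dst`, `a`, `b` are addresses of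
memory cells, `lbl` is an instruction address. -/
inductive Instr (w : ℕ) : Type
  /-- `mem[dst] := f mem[a] mem[b]`. Every operation on words has unit cost, in particular loading
  a constant, copying, arithmetic (including the high-order word of a product), comparisons,
  bitwise operations and shifts. -/
  | op (f : BitVec w → BitVec w → BitVec w) (dst a b : ℕ)
  /-- `mem[dst] := mem[mem[a]]` -/
  | load (dst a : ℕ)
  /-- `mem[mem[a]] := mem[b]` -/
  | store (a b : ℕ)
  /-- continue at `lbl` if `mem[a] ≠ 0` -/
  | jumpNZ (a lbl : ℕ)
  /-- `mem[dst] := R[mem[a]]`, random access to the read-only reference -/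
  | readRef (dst a : ℕ)
  /-- `mem[dst] :=` the next symbol of the text; continue at `lbl` if the text has ended -/
  | readText (dst lbl : ℕ)
  /-- output the next phrase; it is the fragment of the text of length `mem[a]` that starts where
  the previously output phrase ends -/
  | emit (a : ℕ)
  | halt

/-- A configuration of a word RAM with `M` memory cells of `w` bits. The reference does not occupy
memory, the unread part `text` of the stream is accessible only through `readText`, and the output
`out` is write-only. -/
structure Config (σ w M : ℕ) where
  pc : ℕ
  mem : Fin M → BitVec w
  text : List (Fin σ)
  out : List ℕ

/-- Content of a memory cell (`0` if the cell does not exist). -/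
def readMem {w M : ℕ} (mem : Fin M → BitVec w) (a : ℕ) : BitVec w :=
  if h : a < M then mem ⟨a, h⟩ else 0

/-- Writing to a memory cell (without effect if the cell does not exist). -/
def writeMem {w M : ℕ} (mem : Fin M → BitVec w) (a : ℕ) (v : BitVec w) : Fin M → BitVec w :=
  fun j => if (j : ℕ) = a then v else mem j

/-- The symbol of the reference at position `i` (counted from `0`) as a word. -/
def refSymbol {σ m : ℕ} (w : ℕ) (R : Fin m → Fin σ) (i : ℕ) : BitVec w :=
  if h : i < m then BitVec.ofNat w (R ⟨i, h⟩) else 0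

/-- One unit of time. The result is `none` if the machine has halted. -/
def step {σ m w M : ℕ} (P : List (Instr w)) (R : Fin m → Fin σ) (c : Config σ w M) :
    Option (Config σ w M) :=
  match P[c.pc]? with
  | none => none
  | some .halt => none
  | some (.op f dst a b) =>
    some { c with
      pc := c.pc + 1
      mem := writeMem c.mem dst (f (readMem c.mem a) (readMem c.mem b)) }
  | some (.load dst a) =>
    some { c with
      pc := c.pc + 1
      mem := writeMem c.mem dst (readMem c.mem (readMem c.mem a).toNat) }
  | some (.store a b) =>
    some { c with
      pc := c.pc + 1
      mem := writeMem c.mem (readMem c.mem a).toNat (readMem c.mem b) }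
  | some (.jumpNZ a lbl) =>
    some { c with pc := if readMem c.mem a ≠ 0 then lbl else c.pc + 1 }
  | some (.readRef dst a) =>
    some { c with
      pc := c.pc + 1
      mem := writeMem c.mem dst (refSymbol w R (readMem c.mem a).toNat) }
  | some (.readText dst lbl) =>
    match c.text with
    | [] => some { c with pc := lbl }
    | s :: rest =>
      some { c with
        pc := c.pc + 1
        mem := writeMem c.mem dst (BitVec.ofNat w s)
        text := rest }
  | some (.emit a) =>
    some { c with
      pc := c.pc + 1
      out := c.out ++ [(readMem c.mem a).toNat] }

/-- The output of the computation that starts in the given configuration, provided that it halts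
within the given number of steps. -/
def outputWithin {σ m w M : ℕ} (P : List (Instr w)) (R : Fin m → Fin σ) :
    ℕ → Config σ w M → Option (List ℕ)
  | 0, c =>
    match step P R c with
    | none => some c.out
    | some _ => none
  | t + 1, c =>
    match step P R c with
    | none => some c.out
    | some c' => outputWithin P R t c'

/-- An asymmetric streaming algorithm for references of length `m` over the integer alphabet
`{0, …, σ - 1}`: an arbitrary (in particular, not resource-bounded) preprocessing that maps the
reference to a data structure of `d` words, and a word RAM program for processing the text, which
has `e` additional words of memory. -/
structure Algorithm (m σ w d e : ℕ) where
  preprocess : (Fin m → Fin σ) → Fin d → BitVec w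
  program : List (Instr w)

/-- Start of the text processing phase: the memory consists of the data structure followed by the
additional memory, which is initialized with zeros. -/
def Algorithm.start {m σ w d e n : ℕ} (A : Algorithm m σ w d e)
    (R : Fin m → Fin σ) (T : Fin n → Fin σ) : Config σ w (d + e) where
  pc := 0
  mem := Fin.append (A.preprocess R) (fun _ : Fin e => 0)
  text := List.ofFn T
  out := []

/-- After preprocessing `R`, the algorithm processes every text `T` of length `n` satisfying
`z ≤ |rlz(T, R)| ≤ 100 z φ` within `t` steps, and outputs an `R`-factorization of `T` of size at
most `φ * |rlz(T, R)|`. -/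
def Algorithm.Succeeds {m σ w d e : ℕ} (A : Algorithm m σ w d e) (n z φ t : ℕ)
    (R : Fin m → Fin σ) : Prop :=
  ∀ T : Fin n → Fin σ,
    z ≤ (rlz (List.ofFn R) (List.ofFn T)).length →
    (rlz (List.ofFn R) (List.ofFn T)).length ≤ 100 * z * φ →
    ∃ out : List ℕ,
      outputWithin A.program R t (A.start R T) = some out ∧
      IsRFactorization (List.ofFn R) (List.ofFn T) out ∧
      out.length ≤ φ * (rlz (List.ofFn R) (List.ofFn T)).length

end RLZ

namespace RLZ

/-! ### Adaptive queries to a random placement -/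

/-! The hard references come from a uniformly random placement. Each of `g` rows is empty with
probability 1/D, where D = 16000 φ; otherwise it holds, at one of `b` slots, a block of L = 80 φ
symbols that occur nowhere else in the reference. The texts list such blocks, each behind two
markers absent from the reference. A phrase of length at least two is a substring of the reference,
so a block that meets one belongs to a nonempty row. If few rows are empty, the greedy factorization
has O(z) phrases, and a φ-approximation has too few phrases to spell out half of the blocks symbol
by symbol. Its long phrases therefore name at least half of the rows, all of them nonempty.

Blind naming of g/2 rows is correct with probability about exp(-g/(2D)), and a row becomes safe to
name only once its occupied slot is found, which takes about `b` probes. A potential argument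
(`card_successes_le`, `card_correct_le`) bounds the success probability by exp(-g/(4D)) for up to
gb/16 adaptive probes. A machine step reads at most one reference symbol, which is one probe
(`queryBound_evolve`).

The initial memory depends on the placement, so a union bound over all starting configurations is
taken (`card_le_of_queryBound`). With g at least g₀ = 64000(C+16)φS the failure exponent is at least
(C+16)S, while there are at most 2^((C+7)S) starts. On the other hand, averaging over the randomized
algorithm and Markov's inequality for the empty rows leave one deterministic algorithm that is good
for 1/200 of the placements (`exists_card_goodPlacements`).

If z < g₀, a text has room for only z blocks; the machine is run from one data structure on several
texts that together contain all rows (`short_texts`). If z ≥ g₀, one text repeats all g₀ blocks in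
about z/g₀ periods, and some period is processed in few steps with few phrases (`exists_round`,
`long_text`). Either way the time is of order z b, and b is of order m/(φ² S). -/

/-- A placement assigns to each of `g` rows a slot among `b`, together with a tag; the tag `0`
means that the row is empty. -/
abbrev Placement (g D b : ℕ) := Fin g → Fin D × Fin b

/-- Row `i` of the placement is nonempty. -/
def Present {g D b : ℕ} (x : Placement g D b) (i : Fin g) : Prop := (x i).1.val ≠ 0

instance {g D b : ℕ} (x : Placement g D b) (i : Fin g) : Decidable (Present x i) :=
  inferInstanceAs (Decidable (_ ≠ _))

/-- Row `i` of the placement is occupied at slot `s`. -/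
def Occupied {g D b : ℕ} (x : Placement g D b) (i : Fin g) (s : Fin b) : Prop :=
  (x i).1.val ≠ 0 ∧ (x i).2 = s

instance {g D b : ℕ} (x : Placement g D b) (i : Fin g) (s : Fin b) : Decidable (Occupied x i s) :=
  inferInstanceAs (Decidable (_ ∧ _))

/-- The function `f` can be evaluated with `k` adaptive queries of the form `Occupied x i s`. -/
inductive QueryBound {g D b : ℕ} {α : Type} : ℕ → (Placement g D b → α) → Prop
  | const (k : ℕ) (a : α) : QueryBound k (fun _ => a)
  | query {k : ℕ} (i : Fin g) (s : Fin b) {f₁ f₀ : Placement g D b → α} :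
      QueryBound k f₁ → QueryBound k f₀ →
      QueryBound (k + 1) (fun x => if Occupied x i s then f₁ x else f₀ x)

namespace QueryBound

variable {g D b : ℕ} {α β : Type}

theorem mono {k l : ℕ} {f : Placement g D b → α} (h : QueryBound k f) (hkl : k ≤ l) :
    QueryBound l f := by
  induction h generalizing l with
  | const k a => exact .const l a
  | query i s _ _ ih₁ ih₀ =>
    obtain ⟨l, rfl⟩ : ∃ l', l = l' + 1 := ⟨l - 1, by omega⟩
    exact .query i s (ih₁ (by omega)) (ih₀ (by omega))

/-- Adaptivity: the second procedure may depend on the result of the first, so its decision tree is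
grafted onto every leaf. -/
theorem bind {k l : ℕ} {f : Placement g D b → α} {h : α → Placement g D b → β}
    (hf : QueryBound k f) (hh : ∀ a, QueryBound l (h a)) :
    QueryBound (k + l) (fun x => h (f x) x) := by
  induction hf with
  | const k a => exact (hh a).mono (by omega)
  | @query k i s f₁ f₀ _ _ ih₁ ih₀ =>
    have := QueryBound.query i s ih₁ ih₀
    rw [show k + 1 + l = k + l + 1 by omega]
    convert this using 2 with x
    dsimp only
    split_ifs <;> rfl

theorem map {k : ℕ} {f : Placement g D b → α} (hf : QueryBound k f) (h : α → β) :
    QueryBound k (fun x => h (f x)) :=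
  hf.bind (l := 0) (h := fun a _ => h a) fun a => .const 0 (h a)

theorem pi {k : ℕ} : ∀ {J : ℕ} {f : Fin J → Placement g D b → α},
    (∀ j, QueryBound k (f j)) → QueryBound (J * k) (fun x j => f j x)
  | 0, f, _ => by
    have : (fun x (j : Fin 0) => f j x) = fun _ j => j.elim0 := by
      funext x j; exact j.elim0
    rw [this]; exact .const _ _
  | J + 1, f, h => by
    have h1 := QueryBound.pi (J := J) (f := fun j => f j.succ) fun j => h j.succ
    have h2 := (h 0).bind (l := J * k)
      (h := fun a x => (Fin.cons a fun j => f j.succ x : Fin (J + 1) → α))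
      fun a => h1.map fun r => (Fin.cons a r : Fin (J + 1) → α)
    rw [show (J + 1) * k = k + J * k by ring]
    convert h2 using 2 with x
    funext j
    refine Fin.cases ?_ (fun j => ?_) j <;> simp

end QueryBound

/-! ### The potential argument for adaptive probing. -/

section Counting

variable {g D b : ℕ}

/-- What is known about a row: either the set of slots known not to be occupied, or the occupied
slot. -/
abbrev RowInfo (b : ℕ) := Finset (Fin b) ⊕ Fin b

/-- The contents of a row that are consistent with the given information. -/
def consistent (D : ℕ) {b : ℕ} : RowInfo b → Finset (Fin D × Fin b)
  | .inl Z => Finset.univ.filter fun p => p.1.val = 0 ∨ p.2 ∉ Z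
  | .inr s => Finset.univ.filter fun p => p.1.val ≠ 0 ∧ p.2 = s

/-- The potential of a row. -/
noncomputable def potential (D : ℕ) {b : ℕ} : RowInfo b → ℝ
  | .inl Z => D * b - (D - 1) * Z.card + 2 * Z.card - 2 * Z.card ^ 2 / b
  | .inr _ => Real.exp (1 / D) * (D - 1)

theorem card_nonzero (hD : 0 < D) :
    (Finset.univ.filter fun p : Fin D => p.val ≠ 0).card = D - 1 := by
  obtain ⟨D, rfl⟩ : ∃ D', D = D' + 1 := ⟨D - 1, by omega⟩
  have : (Finset.univ.filter fun p : Fin (D + 1) => p.val ≠ 0) = Finset.univ.erase 0 := by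
    ext p
    simp only [Finset.mem_filter, Finset.mem_univ, true_and, Finset.mem_erase, and_true, ne_eq,
      Fin.ext_iff, Fin.val_zero]
  rw [this, Finset.card_erase_of_mem (Finset.mem_univ _)]; simp

theorem card_zero (hD : 0 < D) :
    (Finset.univ.filter fun p : Fin D => p.val = 0).card = 1 := by
  obtain ⟨D, rfl⟩ : ∃ D', D = D' + 1 := ⟨D - 1, by omega⟩
  have : (Finset.univ.filter fun p : Fin (D + 1) => p.val = 0) = {0} := by
    ext p
    simp only [Finset.mem_filter, Finset.mem_univ, true_and, Finset.mem_singleton, Fin.ext_iff,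
      Fin.val_zero]
  rw [this]; simp

theorem card_consistent_present_inl (hD : 0 < D) (Z : Finset (Fin b)) :
    (((consistent D (.inl Z)).filter fun p => p.1.val ≠ 0).card : ℝ) = (D - 1) * (b - Z.card) := by
  have : (consistent D (.inl Z)).filter (fun p => p.1.val ≠ 0) =
      (Finset.univ.filter fun p : Fin D => p.val ≠ 0) ×ˢ Zᶜ := by
    ext p; simp [consistent]; tauto
  rw [this, Finset.card_product, card_nonzero hD, Finset.card_compl, Fintype.card_fin]
  have : Z.card ≤ b := by simpa using Z.card_le_univ
  push_cast [Nat.cast_sub (show 1 ≤ D from hD), Nat.cast_sub this]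
  ring

theorem card_consistent_inl (hD : 0 < D) (Z : Finset (Fin b)) :
    ((consistent D (.inl Z)).card : ℝ) = D * b - (D - 1) * Z.card := by
  have h0 : (consistent D (.inl Z)).filter (fun p => ¬ p.1.val ≠ 0) =
      (Finset.univ.filter fun p : Fin D => p.val = 0) ×ˢ Finset.univ := by
    ext p; simp [consistent]; tauto
  rw [← Finset.card_filter_add_card_filter_not (s := consistent D (.inl Z))
    (fun p => p.1.val ≠ 0)]
  push_cast
  rw [card_consistent_present_inl hD, h0, Finset.card_product, card_zero hD]
  simp
  ring

theorem card_consistent_inr (hD : 0 < D) (s : Fin b) :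
    ((consistent D (.inr s)).card : ℝ) = D - 1 := by
  have : consistent D (.inr s) = (Finset.univ.filter fun p : Fin D => p.val ≠ 0) ×ˢ {s} := by
    ext ⟨p, s'⟩
    simp only [consistent, Finset.mem_filter, Finset.mem_univ, true_and, Finset.mem_product,
      Finset.mem_singleton]
  rw [this, Finset.card_product, card_nonzero hD]
  simp [Nat.cast_sub (show 1 ≤ D from hD)]

theorem exp_inv_le (hD : 0 < D) : Real.exp (1 / D) * (D - 1) ≤ D - 1 + 2 := by
  have hD' : (1 : ℝ) ≤ D := by exact_mod_cast hD
  have h1 : |Real.exp (1 / D) - 1| ≤ 2 * |1 / (D : ℝ)| := by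
    apply Real.abs_exp_sub_one_le
    rw [abs_of_nonneg (by positivity), div_le_one (by linarith)]
    exact hD'
  rw [abs_of_nonneg (a := 1 / (D : ℝ)) (by positivity)] at h1
  have h2 := (abs_le.1 h1).2
  have h3 : (Real.exp (1 / D) - 1) * (D - 1) ≤ 2 * (1 / D) * (D - 1) :=
    mul_le_mul_of_nonneg_right h2 (by linarith)
  have h4 : 2 * (1 / (D : ℝ)) * (D - 1) ≤ 2 := by
    rw [show 2 * (1 / (D : ℝ)) * (D - 1) = 2 * ((D - 1) / D) by ring]
    have : ((D : ℝ) - 1) / D ≤ 1 := by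
      rw [div_le_one (by linarith)]; linarith
    linarith
  linarith

theorem slack_nonneg (Z : Finset (Fin b)) : (0 : ℝ) ≤ 2 * Z.card - 2 * Z.card ^ 2 / b := by
  rcases Nat.eq_zero_or_pos b with rfl | hb
  · simp
  have : (Z.card : ℝ) ≤ b := by exact_mod_cast (by simpa using Z.card_le_univ)
  have hb' : (0 : ℝ) < b := by exact_mod_cast hb
  rw [sub_nonneg, div_le_iff₀ hb']
  have : (0 : ℝ) ≤ Z.card := by positivity
  nlinarith

theorem potential_ge_card (hD : 0 < D) (r : RowInfo b) :
    ((consistent D r).card : ℝ) ≤ potential D r := by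
  have hD' : (1 : ℝ) ≤ D := by exact_mod_cast hD
  cases r with
  | inl Z =>
    have := slack_nonneg Z
    rw [card_consistent_inl hD, potential]; linarith
  | inr s =>
    rw [card_consistent_inr hD, potential]
    have : 1 ≤ Real.exp (1 / D) := Real.one_le_exp (by positivity)
    nlinarith

/-- Naming a row gains a factor exp(-1/D). For a row not yet located, empty contents make up at
least a fraction 1/D of the consistent ones. For a located row nothing is lost by naming it, and the
factor exp(1/D) in its potential pays for this in advance. -/
theorem card_present_le (hD : 0 < D) (r : RowInfo b) :
    (((consistent D r).filter fun p => p.1.val ≠ 0).card : ℝ) ≤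
      Real.exp (-(1 / D)) * potential D r := by
  have hD' : (1 : ℝ) ≤ D := by exact_mod_cast hD
  cases r with
  | inl Z =>
    have h0 := slack_nonneg Z
    have hZ : (Z.card : ℝ) ≤ b := by exact_mod_cast (by simpa using Z.card_le_univ)
    have hZ0 : (0 : ℝ) ≤ Z.card := by positivity
    rw [card_consistent_present_inl hD]
    have h1 : 1 - 1 / (D : ℝ) ≤ Real.exp (-(1 / D)) := by
      have := Real.add_one_le_exp (-(1 / (D : ℝ))); linarith
    have h2 : (0 : ℝ) ≤ D * b - (D - 1) * Z.card := by nlinarith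
    have h3 : (D * b - (D - 1) * Z.card : ℝ) ≤ potential D (.inl Z) := by
      rw [potential]; linarith
    calc ((D : ℝ) - 1) * (b - Z.card)
        ≤ (1 - 1 / D) * (D * b - (D - 1) * Z.card) := by
          have : (1 - 1 / (D : ℝ)) * (D * b - (D - 1) * Z.card)
            = (D - 1) * (b - (D - 1) / D * Z.card) := by field_simp
          rw [this]
          have : ((D : ℝ) - 1) / D ≤ 1 := by
            rw [div_le_one (by linarith)]; linarith
          apply mul_le_mul_of_nonneg_left _ (by linarith)
          nlinarith
      _ ≤ Real.exp (-(1 / D)) * (D * b - (D - 1) * Z.card) := mul_le_mul_of_nonneg_right h1 h2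
      _ ≤ _ := mul_le_mul_of_nonneg_left h3 (Real.exp_pos _).le
  | inr s =>
    rw [potential, ← mul_assoc, ← Real.exp_add]
    simp only [neg_add_cancel, Real.exp_zero, one_mul]
    rw [← card_consistent_inr hD s]
    exact_mod_cast Finset.card_filter_le _ _

/-- The counts of consistent contents add up exactly under a query, so only the excess matters. The
located branch exceeds its count by at most 2 (`exp_inv_le`), and the slack 2|Z| - 2|Z|²/b grows by
less than 2 - 4|Z|/b. The total is below 4(1 - |Z|/b), which is at most 4/(Db) times the old count
because that count is at least D(b - |Z|). The quadratic term is there to make the excess fade with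
the number of unprobed slots. -/
theorem potential_step (hD : 0 < D) (hb : 0 < b) (Z : Finset (Fin b)) (s : Fin b) (hs : s ∉ Z) :
    potential D (.inl (insert s Z)) + potential D (.inr s) ≤
      (1 + 4 / (D * b)) * potential D (.inl Z) := by
  have hD' : (1 : ℝ) ≤ D := by exact_mod_cast hD
  have hb' : (1 : ℝ) ≤ b := by exact_mod_cast hb
  have hZ0 : (0 : ℝ) ≤ Z.card := by positivity
  have h0 := slack_nonneg Z
  have h1 := exp_inv_le hD
  have h2 : 4 / ((D : ℝ) * b) * (D * b - (D - 1) * Z.card) ≤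
      4 / (D * b) * potential D (.inl Z) := by
    apply mul_le_mul_of_nonneg_left _ (by positivity)
    rw [potential]; linarith
  have h3 : 4 / ((D : ℝ) * b) * (D * b - (D - 1) * Z.card) ≥ 4 - 4 * Z.card / b := by
    have : 4 / ((D : ℝ) * b) * (D * b - (D - 1) * Z.card) - (4 - 4 * Z.card / b)
        = 4 * Z.card / (D * b) := by field_simp; ring
    have : (0 : ℝ) ≤ 4 * Z.card / (D * b) := by positivity
    linarith
  have h4 : potential D (.inl (insert s Z)) = potential D (.inl Z) - (D - 1) + 2
      - 4 * Z.card / b - 2 / b := by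
    simp only [potential, Finset.card_insert_of_notMem hs]
    push_cast
    field_simp
    ring
  have h5 : (0 : ℝ) ≤ 2 / b := by positivity
  have h6 : potential D (.inr s) ≤ D - 1 + 2 := h1
  rw [h4]
  linarith

theorem potential_nonneg (hD : 0 < D) (r : RowInfo b) : 0 ≤ potential D r :=
  le_trans (by positivity) (potential_ge_card hD r)

theorem prod_update {ι : Type} [Fintype ι] [DecidableEq ι] {β : Type} (F : β → ℝ) (st : ι → β)
    (i : ι) (r : β) :
    ∏ j, F (Function.update st i r j) = F r * ∏ j ∈ Finset.univ.erase i, F (st j) := by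
  rw [← Finset.mul_prod_erase _ _ (Finset.mem_univ i)]
  simp only [Function.update_self]
  congr 1
  apply Finset.prod_congr rfl
  intro j hj
  rw [Function.update_of_ne (Finset.ne_of_mem_erase hj)]

open Classical in
/-- The placements consistent with the given information for which the set `f x` has at least `a`
elements, all of which are nonempty rows. -/
noncomputable def successes (f : Placement g D b → Finset (Fin g)) (a : ℕ)
    (st : Fin g → RowInfo b) : Finset (Placement g D b) :=
  Finset.univ.filter fun x =>
    (∀ i, x i ∈ consistent D (st i)) ∧ a ≤ (f x).card ∧ ∀ i ∈ f x, Present x i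

/-- Induction over the decision tree with the information gathered so far as state. At a leaf the
set of rows is fixed and the rows are independent, so the count is a product with one factor
exp(-1/D) per named row. At a query only one factor of the potential changes, and `potential_step`
controls it. -/
theorem card_successes_le (hD : 0 < D) (hb : 0 < b) {k : ℕ} {f : Placement g D b → Finset (Fin g)}
    (hf : QueryBound k f) (a : ℕ) (st : Fin g → RowInfo b) :
    ((successes f a st).card : ℝ) ≤
      Real.exp (-(a / D)) * (1 + 4 / (D * b)) ^ k * ∏ i, potential D (st i) := by
  have hD' : (1 : ℝ) ≤ D := by exact_mod_cast hD
  have hb' : (1 : ℝ) ≤ b := by exact_mod_cast hb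
  have hprod : ∀ st : Fin g → RowInfo b, 0 ≤ ∏ i, potential D (st i) := fun st =>
    Finset.prod_nonneg fun i _ => potential_nonneg hD _
  have hbase : (1 : ℝ) ≤ 1 + 4 / (D * b) := by
    have : (0 : ℝ) ≤ 4 / (D * b) := by positivity
    linarith
  induction hf generalizing st with
  | const k A =>
    by_cases hA : a ≤ A.card
    · have hsub : successes (D := D) (fun _ => A) a st ⊆ Fintype.piFinset fun i =>
          if i ∈ A then (consistent D (st i)).filter fun p => p.1.val ≠ 0
          else consistent D (st i) := by
        intro x hx
        simp only [successes, Finset.mem_filter, Finset.mem_univ, true_and] at hx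
        rw [Fintype.mem_piFinset]
        intro i
        split_ifs with hi
        · exact Finset.mem_filter.2 ⟨hx.1 i, hx.2.2 i hi⟩
        · exact hx.1 i
      have h1 : ((successes (D := D) (fun _ => A) a st).card : ℝ) ≤
          ∏ i, (if i ∈ A then Real.exp (-(1 / D)) else 1) * potential D (st i) := by
        refine le_trans (Nat.cast_le.2 (Finset.card_le_card hsub)) ?_
        rw [Fintype.card_piFinset, Nat.cast_prod]
        apply Finset.prod_le_prod
        · intro i _; positivity
        · intro i _
          split_ifs
          · exact card_present_le hD _
          · rw [one_mul]; exact potential_ge_card hD _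
      refine h1.trans ?_
      rw [Finset.prod_mul_distrib]
      apply mul_le_mul_of_nonneg_right _ (hprod st)
      rw [Finset.prod_ite_mem, Finset.univ_inter, Finset.prod_const, ← Real.exp_nat_mul]
      have h2 : (1 : ℝ) ≤ (1 + 4 / (D * b)) ^ k := one_le_pow₀ hbase
      have h3 : Real.exp (A.card * -(1 / (D : ℝ))) ≤ Real.exp (-(a / D)) := by
        apply Real.exp_le_exp.2
        have : (a : ℝ) ≤ A.card := by exact_mod_cast hA
        have : (a : ℝ) / D ≤ A.card / D := by gcongr
        have : (A.card : ℝ) * -(1 / (D : ℝ)) = -(A.card / D) := by ring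
        linarith
      have := Real.exp_pos (-((a : ℝ) / D))
      nlinarith
    · have : successes (D := D) (fun _ => A) a st = ∅ := by
        ext x; simp [successes, hA]
      rw [this, Finset.card_empty, Nat.cast_zero]
      have := hprod st
      positivity
  | @query k i s f₁ f₀ _ _ ih₁ ih₀ =>
    set P := Real.exp (-((a : ℝ) / D)) * (1 + 4 / (D * b)) ^ k with hP
    have hP0 : 0 ≤ P := by positivity
    have hgoal : Real.exp (-((a : ℝ) / D)) * (1 + 4 / (D * b)) ^ (k + 1) *
        ∏ i, potential D (st i) = P * ((1 + 4 / (D * b)) * ∏ i, potential D (st i)) := by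
      rw [hP, pow_succ]; ring
    rw [hgoal]
    have hmono : P * ∏ i, potential D (st i) ≤
        P * ((1 + 4 / (D * b)) * ∏ i, potential D (st i)) := by
      apply mul_le_mul_of_nonneg_left _ hP0
      have := hprod st
      nlinarith
    -- If the answer is already forced by what is known about row `i`, only one branch of the tree
    -- is reachable.
    have key₁ : (∀ x : Placement g D b, x i ∈ consistent D (st i) → Occupied x i s) →
        ((successes (fun x => if Occupied x i s then f₁ x else f₀ x) a st).card : ℝ) ≤
          P * ∏ i, potential D (st i) := by
      intro h
      refine le_trans (Nat.cast_le.2 (Finset.card_le_card ?_)) (ih₁ st)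
      intro x hx
      simp only [successes, Finset.mem_filter, Finset.mem_univ, true_and] at hx ⊢
      simpa only [if_pos (h x (hx.1 i))] using hx
    have key₀ : (∀ x : Placement g D b, x i ∈ consistent D (st i) → ¬ Occupied x i s) →
        ((successes (fun x => if Occupied x i s then f₁ x else f₀ x) a st).card : ℝ) ≤
          P * ∏ i, potential D (st i) := by
      intro h
      refine le_trans (Nat.cast_le.2 (Finset.card_le_card ?_)) (ih₀ st)
      intro x hx
      simp only [successes, Finset.mem_filter, Finset.mem_univ, true_and] at hx ⊢
      simpa only [if_neg (h x (hx.1 i))] using hx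
    cases hst : st i with
    | inr s' =>
      by_cases hs : s' = s
      · refine (key₁ fun x hx => ?_).trans hmono
        rw [hst] at hx
        simp only [consistent, Finset.mem_filter, Finset.mem_univ, true_and] at hx
        exact ⟨hx.1, hx.2.trans hs⟩
      · refine (key₀ fun x hx ho => ?_).trans hmono
        rw [hst] at hx
        simp only [consistent, Finset.mem_filter, Finset.mem_univ, true_and] at hx
        exact hs (hx.2.symm.trans ho.2)
    | inl Z =>
      by_cases hs : s ∈ Z
      · refine (key₀ fun x hx ho => ?_).trans hmono
        rw [hst] at hx
        simp only [consistent, Finset.mem_filter, Finset.mem_univ, true_and] at hx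
        rcases hx with hx | hx
        · exact ho.1 hx
        · rw [ho.2] at hx; exact hx hs
      -- The only informative query: an unlocated row at a slot not probed before.
      · have hsub : successes (fun x => if Occupied x i s then f₁ x else f₀ x) a st ⊆
            successes f₁ a (Function.update st i (.inr s)) ∪
              successes f₀ a (Function.update st i (.inl (insert s Z))) := by
          intro x hx
          simp only [successes, Finset.mem_union, Finset.mem_filter, Finset.mem_univ,
            true_and] at hx ⊢
          have hxi := hx.1 i
          rw [hst] at hxi
          simp only [consistent, Finset.mem_filter, Finset.mem_univ, true_and] at hxi
          by_cases ho : Occupied x i s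
          · simp only [if_pos ho] at hx
            refine Or.inl ⟨fun j => ?_, hx.2⟩
            rcases eq_or_ne j i with rfl | hj
            · simpa [consistent, Occupied] using ho
            · simpa [Function.update_of_ne hj] using hx.1 j
          · simp only [if_neg ho] at hx
            refine Or.inr ⟨fun j => ?_, hx.2⟩
            rcases eq_or_ne j i with rfl | hj
            · simp only [Function.update_self, consistent, Finset.mem_filter, Finset.mem_univ,
                true_and, Finset.mem_insert, not_or]
              by_cases h0 : (x j).1.val = 0
              · exact Or.inl h0
              · exact Or.inr ⟨fun h => ho ⟨h0, h⟩, hxi.resolve_left h0⟩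
            · simpa [Function.update_of_ne hj] using hx.1 j
        have h1 := ih₁ (Function.update st i (.inr s))
        have h0 := ih₀ (Function.update st i (.inl (insert s Z)))
        rw [prod_update] at h1 h0
        have h2 : ((successes (fun x => if Occupied x i s then f₁ x else f₀ x) a st).card : ℝ) ≤
            (successes f₁ a (Function.update st i (.inr s))).card +
              (successes f₀ a (Function.update st i (.inl (insert s Z)))).card := by
          exact_mod_cast (Finset.card_le_card hsub).trans (Finset.card_union_le _ _)
        rw [← Finset.mul_prod_erase _ (fun j => potential D (st j)) (Finset.mem_univ i), hst]
        set Q := ∏ j ∈ Finset.univ.erase i, potential D (st j)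
        have hQ : 0 ≤ Q := Finset.prod_nonneg fun i _ => potential_nonneg hD _
        have h3 := mul_le_mul_of_nonneg_left
          (mul_le_mul_of_nonneg_right (potential_step hD hb Z s hs) hQ) hP0
        calc _ ≤ _ := h2
          _ ≤ _ := add_le_add h1 h0
          _ = P * ((potential D (.inl (insert s Z)) + potential D (.inr s)) * Q) := by ring
          _ ≤ _ := h3
          _ = _ := by ring

open Classical in
/-- A procedure that makes few queries rarely names half of the rows without naming an empty
one. -/
theorem card_correct_le (hD : 0 < D) (hb : 0 < b) {k : ℕ} {f : Placement g D b → Finset (Fin g)}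
    (hf : QueryBound k f) (hk : 16 * k ≤ g * b) :
    ((Finset.univ.filter fun x : Placement g D b =>
      g ≤ 2 * (f x).card ∧ ∀ i ∈ f x, Present x i).card : ℝ) ≤
      Fintype.card (Placement g D b) * Real.exp (-(g / (4 * D))) := by
  have hD' : (1 : ℝ) ≤ D := by exact_mod_cast hD
  have hb' : (1 : ℝ) ≤ b := by exact_mod_cast hb
  have h1 := card_successes_le hD hb hf ((g + 1) / 2) fun _ => .inl ∅
  have h2 : (Finset.univ.filter fun x : Placement g D b =>
      g ≤ 2 * (f x).card ∧ ∀ i ∈ f x, Present x i) ⊆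
      successes f ((g + 1) / 2) fun _ => .inl ∅ := by
    intro x hx
    simp only [Finset.mem_filter, Finset.mem_univ, true_and] at hx
    simp only [successes, Finset.mem_filter, Finset.mem_univ, true_and, consistent]
    refine ⟨by simp, by omega, hx.2⟩
  refine (Nat.cast_le.2 (Finset.card_le_card h2)).trans (h1.trans ?_)
  have h3 : potential D (b := b) (.inl ∅) = D * b := by simp [potential]
  rw [Finset.prod_const, h3]
  simp only [Finset.card_univ, Fintype.card_pi, Fintype.card_prod, Fintype.card_fin,
    Finset.prod_const, Nat.cast_pow, Nat.cast_mul]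
  rw [mul_comm]
  apply mul_le_mul_of_nonneg_left _ (by positivity)
  have h4 : (1 + 4 / ((D : ℝ) * b)) ^ k ≤ Real.exp (k * (4 / (D * b))) := by
    rw [Real.exp_nat_mul]
    apply pow_le_pow_left₀ (by positivity)
    rw [add_comm]; exact Real.add_one_le_exp _
  refine (mul_le_mul_of_nonneg_left h4 (Real.exp_pos _).le).trans ?_
  rw [← Real.exp_add, Real.exp_le_exp]
  have h5 : (g : ℝ) / 2 ≤ ((g + 1) / 2 : ℕ) := by
    have : g ≤ 2 * ((g + 1) / 2) := by omega
    have : (g : ℝ) ≤ 2 * ((g + 1) / 2 : ℕ) := by exact_mod_cast this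
    linarith
  have h6 : (g : ℝ) / 2 / D ≤ ((g + 1) / 2 : ℕ) / D := by gcongr
  -- The allowance of gb/16 queries costs at most half of the exponent g/(2D) gained by naming half
  -- of the rows.
  have h7 : (k : ℝ) * (4 / (D * b)) ≤ g / (4 * D) := by
    have : 16 * (k : ℝ) ≤ g * b := by exact_mod_cast hk
    rw [mul_div_assoc', div_le_div_iff₀ (by positivity) (by positivity)]
    nlinarith
  have h8 : (g : ℝ) / 2 / D = 2 * (g / (4 * D)) := by field_simp; norm_num
  linarith

end Counting

end RLZ

namespace RLZ

/-! ### Properties of factorizations -/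

section Strings

variable {α : Type}

theorem longestMatch_le [DecidableEq α] (R T : List α) : longestMatch R T ≤ T.length :=
  Nat.findGreatest_le _

theorem take_longestMatch [DecidableEq α] (R T : List α) : T.take (longestMatch R T) <:+: R :=
  Nat.findGreatest_spec (P := fun l => T.take l <:+: R) (Nat.zero_le _) (by simp)

theorem le_longestMatch [DecidableEq α] {R T : List α} {l : ℕ} (hl : l ≤ T.length) (h : T.take l <:+: R) :
    l ≤ longestMatch R T :=
  Nat.le_findGreatest hl h

theorem longestMatch_le_drop [DecidableEq α] (R T : List α) (k : ℕ) :
    longestMatch R T ≤ longestMatch R (T.drop k) + k := by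
  have h : (T.drop k).take (longestMatch R T - k) <:+: R := by
    rw [← List.drop_take]
    exact (List.drop_suffix _ _).isInfix.trans (take_longestMatch R T)
  have := le_longestMatch (by have := longestMatch_le R T; simp; omega) h
  omega

/-- Length of the first factor. -/
def firstFactor [DecidableEq α] (R T : List α) : ℕ := max 1 (longestMatch R T)

theorem rlz_of_ne_nil [DecidableEq α] (R : List α) {T : List α} (hT : T ≠ []) :
    rlz R T = T.take (firstFactor R T) :: rlz R (T.drop (firstFactor R T)) := by
  cases T with
  | nil => exact absurd rfl hT
  | cons c T => rw [rlz]; rfl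

theorem one_le_firstFactor [DecidableEq α] (R T : List α) : 1 ≤ firstFactor R T := le_max_left _ _

theorem firstFactor_le [DecidableEq α] (R : List α) {T : List α} (hT : T ≠ []) :
    firstFactor R T ≤ T.length :=
  max_le (List.length_pos_iff.2 hT) (longestMatch_le R T)

/-- When the cut falls inside the first factor, the factor that starts at the cut ends no earlier
than the original one, because substrings of `R` are closed under suffixes. The remainders are then
compared by induction. -/
theorem length_rlz_drop_le [DecidableEq α] (R : List α) : ∀ (N : ℕ) (T : List α), T.length ≤ N → ∀ k,
    (rlz R (T.drop k)).length ≤ (rlz R T).length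
  | 0, T, hT, k => by
    obtain rfl : T = [] := List.length_eq_zero_iff.1 (by omega)
    simp
  | N + 1, T, hT, k => by
    by_cases hne : T = []
    · subst hne; simp
    have h1 := one_le_firstFactor R T
    have h2 := firstFactor_le R hne
    have hlen : (T.drop (firstFactor R T)).length ≤ N := by simp; omega
    have ih := length_rlz_drop_le R N _ hlen
    rw [rlz_of_ne_nil R hne, List.length_cons]
    by_cases hk : firstFactor R T ≤ k
    · have := ih (k - firstFactor R T)
      rw [List.drop_drop, show firstFactor R T + (k - firstFactor R T) = k by omega] at this
      omega
    · have hne' : T.drop k ≠ [] := by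
        intro h; have := List.drop_eq_nil_iff.1 h; omega
      have h3 : firstFactor R T ≤ k + firstFactor R (T.drop k) := by
        have := longestMatch_le_drop R T k
        unfold firstFactor; omega
      rw [rlz_of_ne_nil R hne', List.length_cons, List.drop_drop]
      have := ih (k + firstFactor R (T.drop k) - firstFactor R T)
      rw [List.drop_drop, show firstFactor R T + (k + firstFactor R (T.drop k) - firstFactor R T) =
        k + firstFactor R (T.drop k) by omega] at this
      omega

/-- The greedy factorization is smallest. -/
theorem length_rlz_le [DecidableEq α] {R : List α} : ∀ {ls : List ℕ} {T : List α}, IsRFactorization R T ls →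
    (rlz R T).length ≤ ls.length
  | [], T, h => by
    obtain rfl : T = [] := h
    simp [rlz]
  | l :: ls, T, h => by
    obtain ⟨h1, h2, h3, h4⟩ := h
    have hne : T ≠ [] := by rintro rfl; simp at h2; omega
    have hl : l ≤ firstFactor R T := by
      rcases h3 with h3 | h3
      · rw [h3]; exact one_le_firstFactor R T
      · exact (le_longestMatch h2 h3).trans (le_max_right _ _)
    have ih := length_rlz_le h4
    have := length_rlz_drop_le R _ (T.drop l) le_rfl (firstFactor R T - l)
    rw [List.drop_drop, show l + (firstFactor R T - l) = firstFactor R T by omega] at this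
    rw [rlz_of_ne_nil R hne, List.length_cons, List.length_cons]
    omega

/-- A factor with more than one symbol is a substring of `R` and avoids `c`, so every factor
contains `c` at most once. -/
theorem count_le_length_rlz [DecidableEq α] {R : List α} {c : α} (hc : c ∉ R) : ∀ (N : ℕ) (T : List α),
    T.length ≤ N → T.count c ≤ (rlz R T).length
  | 0, T, hT => by
    obtain rfl : T = [] := List.length_eq_zero_iff.1 (by omega)
    simp
  | N + 1, T, hT => by
    by_cases hne : T = []
    · subst hne; simp
    have h1 := one_le_firstFactor R T
    have h2 := firstFactor_le R hne
    have ih := count_le_length_rlz hc N (T.drop (firstFactor R T)) (by simp; omega)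
    have h3 : (T.take (firstFactor R T)).count c ≤ 1 := by
      by_cases hM : firstFactor R T = 1
      · exact List.count_le_length.trans (by simp [hM])
      · have : firstFactor R T = longestMatch R T := by unfold firstFactor at *; omega
        rw [this, List.count_eq_zero_of_not_mem]
        · omega
        · exact fun h => hc ((take_longestMatch R T).subset h)
    conv_lhs => rw [← List.take_append_drop (firstFactor R T) T]
    rw [rlz_of_ne_nil R hne, List.length_cons, List.count_append]
    omega

theorem IsRFactorization.append {R : List α} : ∀ {ls₁ ls₂ : List ℕ} {T₁ T₂ : List α},
    IsRFactorization R T₁ ls₁ → IsRFactorization R T₂ ls₂ →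
    IsRFactorization R (T₁ ++ T₂) (ls₁ ++ ls₂)
  | [], ls₂, T₁, T₂, h₁, h₂ => by
    obtain rfl : T₁ = [] := h₁
    simpa using h₂
  | l :: ls₁, ls₂, T₁, T₂, ⟨h1, h2, h3, h4⟩, h₂ => by
    refine ⟨h1, by simp; omega, ?_, ?_⟩
    · rwa [List.take_append_of_le_length h2]
    · rw [List.drop_append_of_le_length h2]
      exact IsRFactorization.append h4 h₂

theorem IsRFactorization.drop {R : List α} : ∀ {ls₁ ls₂ : List ℕ} {T : List α},
    IsRFactorization R T (ls₁ ++ ls₂) → IsRFactorization R (T.drop ls₁.sum) ls₂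
  | [], _, _, h => by simpa using h
  | l :: ls₁, ls₂, T, ⟨_, _, _, h4⟩ => by
    have := IsRFactorization.drop (ls₁ := ls₁) h4
    rwa [List.drop_drop, ← List.sum_cons] at this

theorem IsRFactorization.sum_eq {R : List α} : ∀ {ls : List ℕ} {T : List α},
    IsRFactorization R T ls → ls.sum = T.length
  | [], T, h => by
    obtain rfl : T = [] := h
    rfl
  | l :: ls, T, ⟨_, h2, _, h4⟩ => by
    have := IsRFactorization.sum_eq h4
    rw [List.sum_cons, this, List.length_drop]
    omega

/-- `T` has an `R`-factorization into at most `k` phrases. -/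
def Factors (R T : List α) (k : ℕ) : Prop := ∃ ls, IsRFactorization R T ls ∧ ls.length ≤ k

theorem Factors.mono {R T : List α} {k l : ℕ} (h : Factors R T k) (hkl : k ≤ l) :
    Factors R T l :=
  let ⟨ls, h1, h2⟩ := h
  ⟨ls, h1, h2.trans hkl⟩

theorem Factors.append {R T₁ T₂ : List α} {k l : ℕ} (h₁ : Factors R T₁ k) (h₂ : Factors R T₂ l) :
    Factors R (T₁ ++ T₂) (k + l) :=
  let ⟨ls₁, a1, a2⟩ := h₁
  let ⟨ls₂, b1, b2⟩ := h₂
  ⟨ls₁ ++ ls₂, a1.append b1, by rw [List.length_append]; omega⟩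

theorem factors_nil (R : List α) : Factors R [] 0 := ⟨[], rfl, le_rfl⟩

theorem factors_length (R : List α) : ∀ T : List α, Factors R T T.length
  | [] => factors_nil R
  | c :: T => by
    obtain ⟨ls, h1, h2⟩ := factors_length R T
    exact ⟨1 :: ls, ⟨le_rfl, by simp, Or.inl rfl, by simpa using h1⟩, by simpa using h2⟩

theorem factors_of_infix {R T : List α} (h : T <:+: R) : Factors R T 1 := by
  by_cases hT : T = []
  · subst hT; exact (factors_nil R).mono (by omega)
  · refine ⟨[T.length], ⟨List.length_pos_iff.2 hT, le_rfl, Or.inr (by simpa using h), ?_⟩, le_rfl⟩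
    simp [IsRFactorization]

theorem Factors.length_rlz_le [DecidableEq α] {R T : List α} {k : ℕ} (h : Factors R T k) :
    (rlz R T).length ≤ k :=
  let ⟨_, h1, h2⟩ := h
  (RLZ.length_rlz_le h1).trans h2

/-- Position `y` lies in a phrase of length at least `2`. -/
def Covered : List ℕ → ℕ → Prop
  | [], _ => False
  | l :: ls, y => if y < l then 2 ≤ l else Covered ls (y - l)

theorem Covered.append : ∀ {ls ls' : List ℕ} {y : ℕ}, Covered ls y → Covered (ls ++ ls') y
  | l :: ls, ls', y, h => by
    rw [List.cons_append, Covered]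
    rw [Covered] at h
    split_ifs at h ⊢ with hy
    · exact h
    · exact Covered.append h

theorem IsRFactorization.mem_of_covered {R : List α} : ∀ {ls : List ℕ} {T : List α} {y : ℕ},
    IsRFactorization R T ls → Covered ls y → ∃ h : y < T.length, T[y] ∈ R
  | l :: ls, T, y, ⟨h1, h2, h3, h4⟩, hc => by
    rw [Covered] at hc
    split_ifs at hc with hy
    · have h5 := h3.resolve_left (by omega)
      refine ⟨by omega, h5.subset ?_⟩
      rw [← List.getElem_take (j := l) (h := by simp; omega)]
      exact List.getElem_mem _
    · obtain ⟨h6, h7⟩ := IsRFactorization.mem_of_covered h4 hc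
      rw [List.length_drop] at h6
      refine ⟨by omega, ?_⟩
      rw [List.getElem_drop] at h7
      simpa only [show l + (y - l) = y by omega] using h7

/-- The strict first inequality puts `y` behind the first symbol of the phrase `l`, which therefore
has length at least two. This is how phrases that straddle a position are detected. -/
theorem covered_append_cons {l y : ℕ} {ls' : List ℕ} : ∀ {ls : List ℕ}, ls.sum < y →
    y < ls.sum + l → Covered (ls ++ l :: ls') y
  | [], h1, h2 => by
    simp only [List.nil_append, Covered, List.sum_nil, zero_add] at *
    rw [if_pos h2]; omega
  | a :: ls, h1, h2 => by
    rw [List.sum_cons] at h1 h2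
    rw [List.cons_append, Covered, if_neg (by omega)]
    exact covered_append_cons (by omega) (by omega)

-- Every uncovered position is by itself a phrase of length one.
open Classical in
theorem card_not_covered_le : ∀ ls : List ℕ,
    ((Finset.range ls.sum).filter fun y => ¬ Covered ls y).card ≤ ls.length
  | [] => by simp
  | l :: ls => by
    have ih := card_not_covered_le ls
    have hsub : ((Finset.range (l :: ls).sum).filter fun y => ¬ Covered (l :: ls) y) ⊆
        insert 0 (((Finset.range ls.sum).filter fun y => ¬ Covered ls y).image (l + ·)) := by
      intro y hy
      rw [Finset.mem_filter, Finset.mem_range, List.sum_cons, Covered] at hy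
      simp only [Finset.mem_insert, Finset.mem_image, Finset.mem_filter, Finset.mem_range]
      split_ifs at hy with h
      · left; omega
      · exact Or.inr ⟨y - l, ⟨by omega, hy.2⟩, by omega⟩
    refine (Finset.card_le_card hsub).trans ((Finset.card_insert_le _ _).trans ?_)
    rw [List.length_cons]
    have := Finset.card_image_le (s := (Finset.range ls.sum).filter fun y => ¬ Covered ls y)
      (f := (l + ·))
    omega

end Strings

end RLZ

namespace RLZ

/-! ### Runs of the machine -/

section Machine

variable {σ m w M : ℕ}

/-- One step; a machine that has halted stays in its configuration. -/
def advance (P : List (Instr w)) (R : Fin m → Fin σ) (c : Config σ w M) : Config σ w M :=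
  (step P R c).getD c

/-- The configuration after `s` steps. -/
def evolve (P : List (Instr w)) (R : Fin m → Fin σ) (s : ℕ) (c : Config σ w M) : Config σ w M :=
  (advance P R)^[s] c

theorem evolve_zero (P : List (Instr w)) (R : Fin m → Fin σ) (c : Config σ w M) :
    evolve P R 0 c = c := rfl

theorem evolve_succ (P : List (Instr w)) (R : Fin m → Fin σ) (s : ℕ) (c : Config σ w M) :
    evolve P R (s + 1) c = evolve P R s (advance P R c) := rfl

theorem evolve_succ' (P : List (Instr w)) (R : Fin m → Fin σ) (s : ℕ) (c : Config σ w M) :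
    evolve P R (s + 1) c = advance P R (evolve P R s c) :=
  Function.iterate_succ_apply' _ _ _

theorem evolve_add (P : List (Instr w)) (R : Fin m → Fin σ) (s s' : ℕ) (c : Config σ w M) :
    evolve P R (s' + s) c = evolve P R s' (evolve P R s c) :=
  Function.iterate_add_apply _ _ _ _

theorem evolve_of_step_eq_none {P : List (Instr w)} {R : Fin m → Fin σ} {c : Config σ w M}
    (h : step P R c = none) (s : ℕ) : evolve P R s c = c := by
  induction s with
  | zero => rfl
  | succ s ih => rw [evolve_succ, advance, h]; exact ih

theorem out_evolve_of_outputWithin {P : List (Instr w)} {R : Fin m → Fin σ} {out : List ℕ} :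
    ∀ {t : ℕ} {c : Config σ w M}, outputWithin P R t c = some out → ∀ {s : ℕ}, t ≤ s →
      (evolve P R s c).out = out
  | 0, c, h, s, _ => by
    rw [outputWithin] at h
    split at h
    · rename_i hs
      rw [evolve_of_step_eq_none hs]; exact Option.some.inj h
    · cases h
  | t + 1, c, h, s, hts => by
    rw [outputWithin] at h
    split at h
    · rename_i hs
      rw [evolve_of_step_eq_none hs]; exact Option.some.inj h
    · rename_i c' hs
      obtain ⟨s, rfl⟩ : ∃ s', s = s' + 1 := ⟨s - 1, by omega⟩
      rw [evolve_succ, advance, hs]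
      exact out_evolve_of_outputWithin h (by omega)

theorem out_advance (P : List (Instr w)) (R : Fin m → Fin σ) (c : Config σ w M) :
    (advance P R c).out = c.out ∨ ∃ l, (advance P R c).out = c.out ++ [l] := by
  unfold advance step
  split
  case h_9 => exact Or.inr ⟨_, rfl⟩
  case h_8 => split <;> exact Or.inl rfl
  all_goals exact Or.inl rfl

theorem out_prefix_evolve (P : List (Instr w)) (R : Fin m → Fin σ) (c : Config σ w M) {s s' : ℕ}
    (h : s ≤ s') : (evolve P R s c).out <+: (evolve P R s' c).out := by
  induction s', h using Nat.le_induction with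
  | base => exact List.prefix_rfl
  | succ s' _ ih =>
    rw [evolve_succ']
    rcases out_advance P R (evolve P R s' c) with h | ⟨l, h⟩ <;> rw [h]
    · exact ih
    · exact ih.trans (List.prefix_append _ _)

theorem text_suffix_advance (P : List (Instr w)) (R : Fin m → Fin σ) (c : Config σ w M) :
    (advance P R c).text <:+ c.text := by
  unfold advance step
  split
  case h_8 =>
    split
    · exact List.suffix_rfl
    · rename_i h
      simp only [Option.getD_some, h]
      exact List.suffix_cons _ _
  all_goals exact List.suffix_rfl

theorem text_suffix_evolve (P : List (Instr w)) (R : Fin m → Fin σ) (c : Config σ w M) (s : ℕ) :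
    (evolve P R s c).text <:+ c.text := by
  induction s with
  | zero => exact List.suffix_rfl
  | succ s ih => rw [evolve_succ']; exact (text_suffix_advance P R _).trans ih

/-- The configurations agree for the next `k` steps, except that the first one has additionally
output `o` before. -/
def Agree (P : List (Instr w)) (o : List ℕ) (k : ℕ) (c c' : Config σ w M) : Prop :=
  c.out = o ++ c'.out ∧
    ((c.pc = c'.pc ∧ c.mem = c'.mem ∧ c.text.take k = c'.text.take k) ∨
      (P.length ≤ c.pc ∧ P.length ≤ c'.pc))

theorem take_pred {α : Type} {T T' : List α} {k : ℕ} (h : T.take (k + 1) = T'.take (k + 1)) :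
    T.take k = T'.take k := by
  have := congrArg (List.take k) h
  simpa [List.take_take] using this

/-- A step consumes at most one text symbol, so the common lookahead shrinks by at most one.
Agreement on at least one symbol also forces both texts to be exhausted or neither. -/
theorem Agree.advance {P : List (Instr w)} {o : List ℕ} {k : ℕ} {c c' : Config σ w M}
    (R : Fin m → Fin σ) (h : Agree P o (k + 1) c c') :
    Agree P o k (advance P R c) (RLZ.advance P R c') := by
  obtain ⟨ho, ⟨hpc, hmem, htext⟩ | ⟨h1, h2⟩⟩ := h
  · obtain ⟨pc, mem, text, out⟩ := c
    obtain ⟨pc', mem', text', out'⟩ := c'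
    simp only at ho hpc hmem htext
    subst hpc hmem ho
    have ht := take_pred htext
    unfold RLZ.advance step
    cases hP : P[pc]? with
    | none => exact ⟨rfl, Or.inl ⟨rfl, rfl, ht⟩⟩
    | some I =>
      cases I with
      | readText dst lbl =>
        cases text with
        | nil =>
          cases text' with
          | nil => exact ⟨rfl, Or.inl ⟨rfl, rfl, ht⟩⟩
          | cons a l => simp at htext
        | cons a l =>
          cases text' with
          | nil => simp at htext
          | cons a' l' =>
            simp only [List.take_succ_cons, List.cons.injEq] at htext
            obtain ⟨rfl, h⟩ := htext
            exact ⟨rfl, Or.inl ⟨rfl, rfl, h⟩⟩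
      | emit a => exact ⟨by simp, Or.inl ⟨rfl, rfl, ht⟩⟩
      | _ => exact ⟨rfl, Or.inl ⟨rfl, rfl, ht⟩⟩
  -- Outside the program both machines have halted for good, whatever their memory.
  · have e : ∀ c : Config σ w M, P.length ≤ c.pc → RLZ.advance P R c = c := fun c hc => by
      simp [RLZ.advance, step, List.getElem?_eq_none hc]
    rw [e c h1, e c' h2]
    exact ⟨ho, Or.inr ⟨h1, h2⟩⟩

theorem Agree.evolve {P : List (Instr w)} {o : List ℕ} (R : Fin m → Fin σ) :
    ∀ {s : ℕ} {c c' : Config σ w M}, Agree P o s c c' →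
      (evolve P R s c).out = o ++ (RLZ.evolve P R s c').out
  | 0, _, _, h => h.1
  | s + 1, c, c', h => by
    rw [evolve_succ, evolve_succ]
    exact Agree.evolve R (h.advance R)

/-! ### Computations as adaptive query procedures. -/

variable {g D b : ℕ}

theorem queryBound_advance (P : List (Instr w)) {R : Placement g D b → Fin m → Fin σ}
    (hR : ∀ p, QueryBound 1 fun x => refSymbol w (R x) p) (c : Config σ w M) :
    QueryBound 1 fun x => advance P (R x) c := by
  unfold advance step
  cases hP : P[c.pc]? with
  | none => exact .const _ _
  | some I =>
    cases I with
    | readRef dst a =>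
      exact (hR (readMem c.mem a).toNat).map fun v =>
        ({ c with pc := c.pc + 1, mem := writeMem c.mem dst v } : Config σ w M)
    | readText dst lbl =>
      cases c.text <;> exact .const _ _
    | _ => exact .const _ _

theorem queryBound_evolve (P : List (Instr w)) {R : Placement g D b → Fin m → Fin σ}
    (hR : ∀ p, QueryBound 1 fun x => refSymbol w (R x) p) :
    ∀ (s : ℕ) (c : Config σ w M), QueryBound s fun x => evolve P (R x) s c
  | 0, c => .const 0 c
  | s + 1, c => by
    have h := (queryBound_advance P hR c).bind (h := fun c x => evolve P (R x) s c)
      fun c => queryBound_evolve P hR s c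
    rw [Nat.add_comm 1 s] at h
    exact h

end Machine

end RLZ

namespace RLZ

/-! ### Segments of sequences -/

section Segments

variable {α : Type}

/-- The segment of length `l` of the sequence `f` that starts at position `a`. -/
def seg (f : ℕ → α) (a l : ℕ) : List α := (List.range l).map fun j => f (a + j)

theorem length_seg (f : ℕ → α) (a l : ℕ) : (seg f a l).length = l := by simp [seg]

theorem getElem_seg (f : ℕ → α) (a l i : ℕ) (h : i < (seg f a l).length) :
    (seg f a l)[i] = f (a + i) := by simp [seg]

theorem seg_congr {f f' : ℕ → α} {a a' l : ℕ} (h : ∀ j < l, f (a + j) = f' (a' + j)) :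
    seg f a l = seg f' a' l :=
  List.map_congr_left fun j hj => h j (List.mem_range.1 hj)

theorem seg_add (f : ℕ → α) (a l l' : ℕ) : seg f a (l + l') = seg f a l ++ seg f (a + l) l' := by
  rw [seg, List.range_add, List.map_append, List.map_map]
  congr 1
  apply List.map_congr_left
  intro j _
  simp [add_assoc]

theorem seg_take (f : ℕ → α) (a l k : ℕ) : (seg f a l).take k = seg f a (min k l) := by
  apply List.ext_getElem
  · simp [length_seg]
  · intro i h1 h2
    rw [List.getElem_take, getElem_seg, getElem_seg]

theorem seg_drop (f : ℕ → α) (a l k : ℕ) : (seg f a l).drop k = seg f (a + k) (l - k) := by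
  apply List.ext_getElem
  · simp [length_seg]
  · intro i h1 h2
    rw [List.getElem_drop, getElem_seg, getElem_seg, add_assoc]

theorem ofFn_eq_seg (f : ℕ → α) (n : ℕ) : List.ofFn (fun i : Fin n => f i) = seg f 0 n := by
  apply List.ext_getElem
  · simp [length_seg]
  · intro i h1 h2
    rw [getElem_seg]; simp

theorem seg_infix (f : ℕ → α) {a l n : ℕ} (h : a + l ≤ n) : seg f a l <:+: seg f 0 n := by
  obtain ⟨r, rfl⟩ := Nat.exists_eq_add_of_le h
  rw [seg_add, seg_add, Nat.zero_add]
  exact ⟨_, _, rfl⟩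

theorem Factors.seg_sum {R : List α} {f : ℕ → α} {a l : ℕ} {c : ℕ → ℕ} :
    ∀ {k : ℕ}, (∀ i < k, Factors R (seg f (a + i * l) l) (c i)) →
      Factors R (seg f a (k * l)) (∑ i ∈ Finset.range k, c i)
  | 0, _ => by
    have := factors_nil R
    simpa [seg] using this
  | k + 1, h => by
    rw [Nat.succ_mul, seg_add, Finset.sum_range_succ]
    exact (Factors.seg_sum fun i hi => h i (by omega)).append (h k (by omega))

theorem count_seg_ge [DecidableEq α] {f : ℕ → α} {a l d : ℕ} {s : α} :
    ∀ {k : ℕ}, (∀ i < k, d ≤ (seg f (a + i * l) l).count s) →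
      k * d ≤ (seg f a (k * l)).count s
  | 0, _ => by simp
  | k + 1, h => by
    rw [Nat.succ_mul, Nat.succ_mul, seg_add, List.count_append]
    exact add_le_add (count_seg_ge fun i hi => h i (by omega)) (h k (by omega))

theorem factors_of_constant {R : List α} {s : α} {M : ℕ} (hM : 0 < M)
    (hR : List.replicate M s <:+: R) : ∀ (N l : ℕ), l ≤ N →
      Factors R (List.replicate l s) (l / M + 1)
  | 0, l, hl => by
    obtain rfl : l = 0 := by omega
    exact (factors_nil R).mono (Nat.zero_le _)
  | N + 1, l, hl => by
    by_cases h : l < M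
    · have : List.replicate l s <:+: R := by
        refine List.IsInfix.trans ?_ hR
        rw [show M = l + (M - l) by omega, List.replicate_add]
        exact List.infix_append' [] _ _
      exact (factors_of_infix this).mono (Nat.le_add_left 1 _)
    · have h1 := factors_of_constant hM hR N (l - M) (by omega)
      have h2 := (factors_of_infix hR).append h1
      rw [← List.replicate_add, show M + (l - M) = l by omega] at h2
      refine h2.mono ?_
      have : l / M = (l - M) / M + 1 := by
        rw [← Nat.sub_add_cancel (show M ≤ l by omega), Nat.add_div_right _ hM]
        simp
      omega

end Segments

/-! ### The hard references and texts -/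

section Instance

variable {g D b : ℕ}

/-- Code of the symbol of the reference at position `p`: every nonempty row `i` contains the block
of the `L` symbols `2 + i * L, 2 + i * L + 1, …` at its occupied slot, all other symbols are `0`. -/
def refCode (L : ℕ) (x : Placement g D b) (p : ℕ) : ℕ :=
  if h : p / (b * L) < g then
    if (x ⟨_, h⟩).1.val ≠ 0 ∧ (x ⟨_, h⟩).2.val = p / L % b then 2 + p / (b * L) * L + p % L else 0
  else 0

/-- Code of the symbol of the text at position `y`. The text has period `u`; a period consists of
the blocks of the rows `o, …, o + q - 1`, each preceded by two symbols `1`, followed by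
symbols `0`. -/
def textCode (L q u o y : ℕ) : ℕ :=
  if y % u < q * (L + 2) then
    if y % u % (L + 2) < 2 then 1 else 2 + (o + y % u / (L + 2)) * L + (y % u % (L + 2) - 2)
  else 0

/-- Row `i` exists and is nonempty. -/
def PresentAt (x : Placement g D b) (i : ℕ) : Prop := ∃ h : i < g, Present x ⟨i, h⟩

open Classical in
/-- Number of empty rows among the rows `o, …, o + q - 1`. -/
noncomputable def missing (x : Placement g D b) (o q : ℕ) : ℕ :=
  ((Finset.range q).filter fun i => ¬ PresentAt x (o + i)).card

theorem refCode_lt {L : ℕ} (hL : 0 < L) (x : Placement g D b) (p : ℕ) :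
    refCode L x p < 2 + g * L := by
  unfold refCode
  split_ifs with h
  · have h1 : (p / (b * L) + 1) * L ≤ g * L := Nat.mul_le_mul_right L h
    have := Nat.mod_lt p hL
    rw [Nat.succ_mul] at h1
    omega
  all_goals omega

theorem refCode_ne_one (L : ℕ) (x : Placement g D b) (p : ℕ) : refCode L x p ≠ 1 := by
  unfold refCode
  split_ifs <;> omega

theorem block_injective {L i i' o o' : ℕ} (ho : o < L) (ho' : o' < L)
    (h : i * L + o = i' * L + o') : i = i' := by
  have h1 : (i * L + o) / L = i := by
    rw [mul_comm, Nat.mul_add_div (by omega), Nat.div_eq_of_lt ho, add_zero]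
  have h2 : (i' * L + o') / L = i' := by
    rw [mul_comm, Nat.mul_add_div (by omega), Nat.div_eq_of_lt ho', add_zero]
  rw [← h1, h, h2]

/-- Distinct rows use disjoint ranges of symbols, so one block symbol in the reference identifies
its row. -/
theorem presentAt_of_refCode {L i o : ℕ} (ho : o < L) {x : Placement g D b} {p : ℕ}
    (h : refCode L x p = 2 + i * L + o) : PresentAt x i := by
  unfold refCode at h
  split_ifs at h with h1 h2
  · have : p / (b * L) = i :=
      block_injective (Nat.mod_lt p (by omega)) ho (by omega)
    subst this
    exact ⟨h1, h2.1⟩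
  all_goals omega

theorem refCode_of_ge {L : ℕ} (hb : 0 < b) (hL : 0 < L) (x : Placement g D b) {p : ℕ}
    (hp : g * b * L ≤ p) : refCode L x p = 0 := by
  unfold refCode
  rw [dif_neg]
  rw [not_lt, Nat.le_div_iff_mul_le (by positivity), ← mul_assoc]
  exact hp

theorem refCode_block {L : ℕ} {x : Placement g D b} {i : Fin g} (hx : Present x i) {o : ℕ}
    (ho : o < L) :
    refCode L x ((i * b + (x i).2) * L + o) = 2 + i * L + o := by
  have hs := (x i).2.isLt
  have e1 : ((i * b + (x i).2) * L + o) / L = i * b + (x i).2 := by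
    rw [mul_comm, Nat.mul_add_div (by omega), Nat.div_eq_of_lt ho, add_zero]
  have e2 : ((i * b + (x i).2 : ℕ) * L + o) / (b * L) = i := by
    rw [mul_comm b L, ← Nat.div_div_eq_div_mul, e1, mul_comm, Nat.mul_add_div (by omega),
      Nat.div_eq_of_lt hs, add_zero]
  have e3 : ((i * b + (x i).2 : ℕ) * L + o) % L = o := by
    rw [Nat.mul_add_mod_self_right, Nat.mod_eq_of_lt ho]
  have e4 : ((i * b + (x i).2) : ℕ) % b = (x i).2 := by
    rw [Nat.mul_add_mod_self_right, Nat.mod_eq_of_lt hs]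
  unfold refCode
  rw [dif_pos (by rw [e2]; exact i.isLt)]
  simp only [e1, e2, e3, e4]
  rw [if_pos ⟨hx, trivial⟩]

theorem textCode_period (L q u o y k : ℕ) : textCode L q u o (k * u + y) = textCode L q u o y := by
  simp [textCode, Nat.mul_add_mod_self_right]

theorem textCode_lt {L q u o : ℕ} (h : o + q ≤ g) (y : ℕ) :
    textCode L q u o y < 2 + g * L := by
  unfold textCode
  split_ifs with h1 h2
  · omega
  · have h3 : y % u / (L + 2) < q := by
      rwa [Nat.div_lt_iff_lt_mul (by omega)]
    have h4 : (o + y % u / (L + 2) + 1) * L ≤ g * L := Nat.mul_le_mul_right L (by omega)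
    have := Nat.mod_lt (y % u) (show 0 < L + 2 by omega)
    rw [Nat.succ_mul] at h4
    omega
  · omega

theorem textCode_block {L q u o : ℕ} (hu : q * (L + 2) ≤ u) {i r : ℕ} (hi : i < q)
    (hr : r < L + 2) :
    textCode L q u o (i * (L + 2) + r) = if r < 2 then 1 else 2 + (o + i) * L + (r - 2) := by
  have h1 : (i + 1) * (L + 2) ≤ q * (L + 2) := Nat.mul_le_mul_right _ hi
  rw [Nat.succ_mul] at h1
  have e1 : (i * (L + 2) + r) % u = i * (L + 2) + r := Nat.mod_eq_of_lt (by omega)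
  have e2 : (i * (L + 2) + r) / (L + 2) = i := by
    rw [mul_comm, Nat.mul_add_div (by omega), Nat.div_eq_of_lt hr, add_zero]
  have e3 : (i * (L + 2) + r) % (L + 2) = r := by
    rw [Nat.mul_add_mod_self_right, Nat.mod_eq_of_lt hr]
  unfold textCode
  rw [e1, if_pos (by omega), e2, e3]

theorem textCode_tail {L q u o y : ℕ} (h1 : q * (L + 2) ≤ y) (h2 : y < u) :
    textCode L q u o y = 0 := by
  unfold textCode
  rw [Nat.mod_eq_of_lt h2, if_neg (by omega)]

variable {σ : ℕ} [NeZero σ]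

theorem ofNat_inj {v v' : ℕ} (h : v < σ) (h' : v' < σ) (e : Fin.ofNat σ v = Fin.ofNat σ v') :
    v = v' := by
  have := congrArg Fin.val e
  simpa [Fin.ofNat, Nat.mod_eq_of_lt h, Nat.mod_eq_of_lt h'] using this

/-- The symbols of the reference, as a sequence. -/
def refSeq (σ : ℕ) [NeZero σ] (L : ℕ) (x : Placement g D b) (p : ℕ) : Fin σ :=
  Fin.ofNat σ (refCode L x p)

/-- The symbols of the text, as a sequence. -/
def textSeq (σ : ℕ) [NeZero σ] (L q u o y : ℕ) : Fin σ := Fin.ofNat σ (textCode L q u o y)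

/-- The hard reference. -/
def reference (m σ : ℕ) [NeZero σ] (L : ℕ) (x : Placement g D b) : Fin m → Fin σ :=
  fun p => refSeq σ L x p

/-- The hard text. -/
def text (n σ : ℕ) [NeZero σ] (L q u o : ℕ) : Fin n → Fin σ := fun y => textSeq σ L q u o y

theorem ofFn_reference (m L : ℕ) (x : Placement g D b) :
    List.ofFn (reference m σ L x) = seg (refSeq σ L x) 0 m := ofFn_eq_seg _ _

theorem ofFn_text (n L q u o : ℕ) :
    List.ofFn (text n σ L q u o) = seg (textSeq σ L q u o) 0 n := ofFn_eq_seg _ _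

theorem textSeq_period (L q u o y k : ℕ) :
    textSeq σ L q u o (k * u + y) = textSeq σ L q u o y := by
  rw [textSeq, textCode_period, textSeq]

theorem mem_seg {α : Type} {f : ℕ → α} {a l : ℕ} {s : α} (h : s ∈ seg f a l) : ∃ p, f p = s := by
  obtain ⟨j, _, rfl⟩ := List.mem_map.1 h
  exact ⟨_, rfl⟩

theorem one_notMem_reference {m L : ℕ} (hL : 0 < L) (hσ : 2 + g * L ≤ σ) (x : Placement g D b) :
    Fin.ofNat σ 1 ∉ seg (refSeq σ L x) 0 m := by
  intro h
  obtain ⟨p, hp⟩ := mem_seg h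
  exact refCode_ne_one L x p (ofNat_inj ((refCode_lt hL x p).trans_le hσ) (by omega) hp)

/-- The position determines the row and the slot; the symbol there depends only on whether that slot
is occupied. -/
theorem queryBound_reference {m L w : ℕ} (hb : 0 < b) (p : ℕ) :
    QueryBound 1 fun x : Placement g D b => refSymbol w (reference m σ L x) p := by
  unfold refSymbol reference refSeq refCode
  by_cases hp : p < m
  · simp only [hp, dite_true]
    by_cases h : p / (b * L) < g
    · simp only [h, dite_true]
      have := QueryBound.query (D := D) ⟨_, h⟩ (⟨p / L % b, Nat.mod_lt _ hb⟩ : Fin b)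
        (.const 0 (BitVec.ofNat w (Fin.ofNat σ (2 + p / (b * L) * L + p % L))))
        (.const 0 (BitVec.ofNat w (Fin.ofNat σ 0)))
      convert this using 2 with x
      simp only [Occupied, Fin.ext_iff]
      split_ifs <;> rfl
    · simp only [h, dite_false]
      exact .const _ _
  · simp only [hp, dite_false]
    exact .const _ _

/-! ### Factorization sizes of the hard texts, and what phrases reveal. -/

section Bounds

variable {m L q u o : ℕ}

/-- Two phrases serve the markers. The block is one phrase if its row is nonempty and is spelled out
otherwise. -/
theorem factors_unit (hm : g * b * L ≤ m) (hu : q * (L + 2) ≤ u)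
    (x : Placement g D b) (a i : ℕ) (hi : i < q) [Decidable (PresentAt x (o + i))] :
    Factors (seg (refSeq σ L x) 0 m) (seg (textSeq σ L q u o) (a * u + i * (L + 2)) (L + 2))
      (3 + if PresentAt x (o + i) then 0 else L) := by
  rw [show L + 2 = 2 + L by ring, seg_add]
  have h2 := factors_length (seg (refSeq σ L x) 0 m)
    (seg (textSeq σ L q u o) (a * u + i * (2 + L)) 2)
  rw [length_seg] at h2
  split_ifs with h
  · obtain ⟨h, hp⟩ := h
    refine h2.append (l := 1) (factors_of_infix ?_)
    have e : seg (textSeq σ L q u o) (a * u + i * (2 + L) + 2) L =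
        seg (refSeq σ L x) (((o + i) * b + (x ⟨o + i, h⟩).2) * L) L := by
      apply seg_congr
      intro j hj
      rw [show a * u + i * (2 + L) + 2 + j = a * u + (i * (L + 2) + (j + 2)) by ring,
        textSeq_period, textSeq, textCode_block hu hi (by omega), if_neg (by omega), refSeq,
        refCode_block hp hj]
      rfl
    rw [e]
    apply seg_infix
    refine le_trans ?_ hm
    rw [← Nat.succ_mul]
    apply Nat.mul_le_mul_right
    have h3 : (o + i + 1) * b ≤ g * b := Nat.mul_le_mul_right b h
    have := (x ⟨o + i, h⟩).2.isLt
    rw [Nat.succ_mul] at h3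
    omega
  · have h3 := factors_length (seg (refSeq σ L x) 0 m)
      (seg (textSeq σ L q u o) (a * u + i * (2 + L) + 2) L)
    rw [length_seg] at h3
    exact (h2.append h3).mono (by omega)

/-- The zeros that pad a period are cut into runs of zeros taken from the end of the reference,
behind all rows. -/
theorem factors_round (hm : g * b * L < m) (hu : q * (L + 2) ≤ u) (hL : 0 < L) (hb : 0 < b)
    (x : Placement g D b) (a : ℕ) :
    Factors (seg (refSeq σ L x) 0 m) (seg (textSeq σ L q u o) (a * u) u)
      (3 * q + missing x o q * L + (u / (m - g * b * L) + 1)) := by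
  classical
  have h1 := Factors.seg_sum (fun i hi => factors_unit (σ := σ) (o := o) hm.le hu x a i hi)
  have e1 : ∑ i ∈ Finset.range q, (3 + if PresentAt x (o + i) then 0 else L) =
      3 * q + missing x o q * L := by
    rw [Finset.sum_add_distrib, Finset.sum_const, Finset.card_range, smul_eq_mul, mul_comm 3 q,
      missing, Finset.card_filter, Finset.sum_mul]
    congr 1
    apply Finset.sum_congr rfl
    intro i _
    split_ifs <;> simp_all
  rw [e1] at h1
  have e2 : seg (textSeq σ L q u o) (a * u + q * (L + 2)) (u - q * (L + 2)) =
      List.replicate (u - q * (L + 2)) (Fin.ofNat σ 0) := by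
    rw [List.eq_replicate_iff]
    refine ⟨length_seg _ _ _, fun s hs => ?_⟩
    obtain ⟨j, hj, rfl⟩ := List.mem_map.1 hs
    rw [List.mem_range] at hj
    rw [add_assoc, textSeq_period, textSeq, textCode_tail (by omega) (by omega)]
  have h2 : List.replicate (m - g * b * L) (Fin.ofNat σ 0) <:+: seg (refSeq σ L x) 0 m := by
    have : seg (refSeq σ L x) (g * b * L) (m - g * b * L) =
        List.replicate (m - g * b * L) (Fin.ofNat σ 0) := by
      rw [List.eq_replicate_iff]
      refine ⟨length_seg _ _ _, fun s hs => ?_⟩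
      obtain ⟨j, hj, rfl⟩ := List.mem_map.1 hs
      rw [refSeq, refCode_of_ge hb hL x (by omega)]
    rw [← this]
    exact seg_infix _ (by omega)
  have h3 := h1.append (e2 ▸ factors_of_constant (by omega) h2 _ (u - q * (L + 2)) le_rfl)
  rw [← seg_add, show q * (L + 2) + (u - q * (L + 2)) = u by omega] at h3
  refine h3.mono ?_
  have : (u - q * (L + 2)) / (m - g * b * L) ≤ u / (m - g * b * L) :=
    Nat.div_le_div_right (by omega)
  omega

theorem factors_text {n K : ℕ} (hm : g * b * L < m) (hu : q * (L + 2) ≤ u) (hL : 0 < L)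
    (hb : 0 < b) (hn : K * u ≤ n) (x : Placement g D b) :
    Factors (seg (refSeq σ L x) 0 m) (seg (textSeq σ L q u o) 0 n)
      (K * (3 * q + missing x o q * L + (u / (m - g * b * L) + 1)) + (n - K * u)) := by
  have h1 := Factors.seg_sum (a := 0) (k := K) (fun i _ => by
    rw [zero_add]
    exact factors_round (σ := σ) (o := o) hm hu hL hb x i)
  rw [Finset.sum_const, Finset.card_range, smul_eq_mul] at h1
  have h2 := factors_length (seg (refSeq σ L x) 0 m) (seg (textSeq σ L q u o) (K * u) (n - K * u))
  rw [length_seg] at h2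
  rw [← zero_add (K * u)] at h2
  have h3 := h1.append h2
  rwa [← seg_add, zero_add, show K * u + (n - K * u) = n by omega] at h3

/-- The 7z splits into 3Kq ≤ 3z for markers and blocks, 2z for full runs of zeros (the zero tail of
the reference has length at least m/2 and n ≤ zm), K ≤ z for one further run per period, and fewer
than K ≤ z symbols after the last period. -/
theorem length_rlz_le_missing {n K z : ℕ} (hm : 2 * (g * b * L) ≤ m) (hm0 : 0 < m)
    (hL : 0 < L) (hb : 0 < b) (hK : 0 < K) (hq : 0 < q) (hKq : K * q ≤ z) (hnz : n ≤ z * m)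
    (hu : q * (L + 2) ≤ n / K) (x : Placement g D b) :
    (rlz (List.ofFn (reference m σ L x)) (List.ofFn (text n σ L q (n / K) o))).length ≤
      7 * z + K * (missing x o q * L) := by
  rw [ofFn_reference, ofFn_text]
  have hKn : K * (n / K) ≤ n := Nat.mul_div_le n K
  refine ((factors_text (K := K) (by omega) hu hL hb hKn x).length_rlz_le).trans ?_
  set M := m - g * b * L with hM
  have h1 : K * (n / K / M) ≤ 2 * z := by
    calc K * (n / K / M) ≤ K * (n / K) / M := Nat.mul_div_le_mul_div_assoc _ _ _
      _ ≤ z * m / M := Nat.div_le_div_right (hKn.trans hnz)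
      _ ≤ 2 * z := by
        apply Nat.div_le_of_le_mul
        have : m ≤ 2 * M := by omega
        nlinarith
  have h2 : n - K * (n / K) < K := by
    have := Nat.mod_add_div n K
    have := Nat.mod_lt n hK
    omega
  have h3 : K ≤ z := le_trans (Nat.le_mul_of_pos_right K hq) hKq
  have e : K * (3 * q + missing x o q * L + (n / K / M + 1)) =
    3 * (K * q) + K * (missing x o q * L) + K * (n / K / M) + K := by ring
  omega

/-- Each marker is a phrase of its own. Having two per block absorbs the rounding in the choice of
`K`, for which only z ≤ 2Kq holds. -/
theorem le_length_rlz {n K z : ℕ} (hσ : 2 + g * L ≤ σ) (hL : 0 < L) (hu : q * (L + 2) ≤ u)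
    (hn : K * u ≤ n) (hz : z ≤ 2 * (K * q)) (x : Placement g D b) :
    z ≤ (rlz (List.ofFn (reference m σ L x)) (List.ofFn (text n σ L q u o))).length := by
  rw [ofFn_reference, ofFn_text]
  refine le_trans ?_ (count_le_length_rlz (one_notMem_reference hL hσ x) _ _ le_rfl)
  have h1 : ∀ a < K, q * 2 ≤ (seg (textSeq σ L q u o) (0 + a * u) u).count (Fin.ofNat σ 1) := by
    intro a _
    rw [zero_add]
    have h2 : q * 2 ≤ (seg (textSeq σ L q u o) (a * u) (q * (L + 2))).count (Fin.ofNat σ 1) := by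
      apply count_seg_ge
      intro i hi
      rw [add_comm L 2, seg_add, List.count_append]
      have : seg (textSeq σ L q u o) (a * u + i * (2 + L)) 2 =
          List.replicate 2 (Fin.ofNat σ 1) := by
        rw [List.eq_replicate_iff]
        refine ⟨length_seg _ _ _, fun s hs => ?_⟩
        obtain ⟨j, hj, rfl⟩ := List.mem_map.1 hs
        rw [List.mem_range] at hj
        rw [add_assoc, textSeq_period, textSeq, add_comm 2 L,
          textCode_block hu hi (by omega), if_pos hj]
      rw [this, List.count_replicate_self]
      omega
    refine h2.trans ?_
    conv_rhs => rw [show u = q * (L + 2) + (u - q * (L + 2)) by omega, seg_add, List.count_append]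
    rw [show q * (L + 2) + (u - q * (L + 2)) = u by omega]
    omega
  have h2 := count_seg_ge h1
  rw [show n = K * u + (n - K * u) by omega, seg_add, List.count_append]
  have e : K * (q * 2) = 2 * (K * q) := by ring
  omega

/-- A phrase of length at least two that meets a block shows that its row is nonempty. -/
theorem presentAt_of_covered {n k : ℕ} {ls ls' : List ℕ} (hσ : 2 + g * L ≤ σ) (hL : 0 < L)
    (hu : q * (L + 2) ≤ u) (ho : o + q ≤ g) {x : Placement g D b}
    (hf : IsRFactorization (List.ofFn (reference m σ L x)) (List.ofFn (text n σ L q u o))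
      (ls ++ ls')) (hs : ls.sum = k * u) {i r : ℕ} (hi : i < q) (hr : r < L)
    (hc : Covered ls' (i * (L + 2) + 2 + r)) : PresentAt x (o + i) := by
  rw [ofFn_reference, ofFn_text] at hf
  obtain ⟨h, hmem⟩ := hf.drop.mem_of_covered hc
  obtain ⟨p, hp⟩ := mem_seg hmem
  rw [List.getElem_drop, getElem_seg, hs, zero_add,
    show k * u + (i * (L + 2) + 2 + r) = k * u + (i * (L + 2) + (2 + r)) by ring,
    textSeq_period] at hp
  have := ofNat_inj ((refCode_lt hL x p).trans_le hσ) ((textCode_lt ho _).trans_le hσ) hp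
  rw [textCode_block hu hi (by omega), if_neg (by omega), Nat.add_sub_cancel_left] at this
  exact presentAt_of_refCode hr this

/-- No phrase crosses the beginning of a period. -/
theorem not_crossing {n k l : ℕ} {ls ls' : List ℕ} (hσ : 2 + g * L ≤ σ) (hL : 0 < L)
    (hq : 0 < q) (hu : q * (L + 2) ≤ u) {x : Placement g D b}
    (hf : IsRFactorization (List.ofFn (reference m σ L x)) (List.ofFn (text n σ L q u o))
      (ls ++ l :: ls')) (h1 : ls.sum < k * u) : ls.sum + l ≤ k * u := by
  by_contra! h2
  rw [ofFn_reference, ofFn_text] at hf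
  -- A crossing phrase would contain the marker at the beginning of the period together with an
  -- earlier symbol, so the marker would occur in the reference.
  obtain ⟨h, hmem⟩ := hf.mem_of_covered (covered_append_cons h1 h2)
  rw [getElem_seg, zero_add] at hmem
  have e := textSeq_period (σ := σ) L q u o 0 k
  rw [add_zero] at e
  rw [e, textSeq] at hmem
  have e2 := textCode_block (o := o) hu hq (show 0 < L + 2 by omega)
  rw [zero_mul, add_zero, if_pos (by omega)] at e2
  rw [e2] at hmem
  exact one_notMem_reference hL hσ x hmem

end Bounds

/-! ### Rows named by the output, and the number of empty rows. -/

open Classical in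
/-- The blocks of the first period that meet a phrase of length at least two. -/
noncomputable def touched (L q : ℕ) (ls : List ℕ) : Finset ℕ :=
  (Finset.range q).filter fun i => ∃ r < L, Covered ls (i * (L + 2) + 2 + r)

theorem touched_append (L q : ℕ) (ls ls' : List ℕ) :
    touched L q ls ⊆ touched L q (ls ++ ls') := by
  intro i hi
  simp only [touched, Finset.mem_filter] at hi ⊢
  obtain ⟨h1, r, h2, h3⟩ := hi
  exact ⟨h1, r, h2, h3.append⟩

/-- An untouched block consists of `L` uncovered positions, and each of these uses up a phrase. -/
theorem mul_le_length_add_touched (L q : ℕ) {ls : List ℕ} (h : q * (L + 2) ≤ ls.sum) :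
    q * L ≤ ls.length + (touched L q ls).card * L := by
  classical
  have h1 := card_not_covered_le ls
  have h2 : (((Finset.range q) \ touched L q ls) ×ˢ Finset.range L).card ≤
      ((Finset.range ls.sum).filter fun y => ¬ Covered ls y).card := by
    apply Finset.card_le_card_of_injOn fun p => p.1 * (L + 2) + 2 + p.2
    · rintro ⟨i, r⟩ hp
      simp only [Finset.coe_product, Set.mem_prod, Finset.mem_coe, Finset.mem_sdiff,
        Finset.mem_range, touched, Finset.mem_filter, not_and, not_exists] at hp
      obtain ⟨⟨hi, hni⟩, hr⟩ := hp
      simp only [Finset.coe_filter, Finset.mem_range, Set.mem_ofPred_eq]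
      refine ⟨?_, hni hi r hr⟩
      have : (i + 1) * (L + 2) ≤ q * (L + 2) := Nat.mul_le_mul_right _ hi
      rw [Nat.succ_mul] at this
      omega
    · rintro ⟨i, r⟩ hp ⟨i', r'⟩ hp' he
      simp only [Finset.coe_product, Set.mem_prod, Finset.mem_coe, Finset.mem_range] at hp hp'
      simp only at he
      have : i = i' := block_injective (L := L + 2) (o := 2 + r) (o' := 2 + r')
        (by omega) (by omega) (by omega)
      subst this
      simp only [Prod.mk.injEq, true_and]
      omega
  rw [Finset.card_product, Finset.card_range,
    Finset.card_sdiff_of_subset (show touched L q ls ⊆ _ from Finset.filter_subset _ _),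
    Finset.card_range, Nat.sub_mul] at h2
  omega

/-- The rows whose blocks meet long phrases, for `J` texts with `q` blocks each. -/
noncomputable def named (L q : ℕ) {J : ℕ} (out : Fin J → List ℕ) : Finset (Fin (J * q)) :=
  (Finset.univ.filter fun p : Fin J × Fin q => p.2.val ∈ touched L q (out p.1)).map
    finProdFinEquiv.toEmbedding

theorem card_named (L q : ℕ) {J : ℕ} (out : Fin J → List ℕ) :
    (named L q out).card = ∑ j, (touched L q (out j)).card := by
  classical
  rw [named, Finset.card_map, Finset.card_filter, Fintype.sum_prod_type]
  apply Finset.sum_congr rfl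
  intro j _
  rw [← Finset.card_filter, ← Finset.card_map Fin.valEmbedding]
  congr 1
  ext i
  simp only [Finset.mem_map, Finset.mem_filter, Finset.mem_univ, true_and, Fin.valEmbedding_apply]
  constructor
  · rintro ⟨i, hi, rfl⟩; exact hi
  · intro hi
    exact ⟨⟨i, Finset.mem_range.1 (Finset.mem_filter.1 hi).1⟩, hi, rfl⟩

theorem sum_missing (q J : ℕ) (x : Placement (J * q) D b) :
    ∑ j : Fin J, missing x (q * j) q =
      (Finset.univ.filter fun i => ¬ Present x i).card := by
  classical
  rw [Finset.card_filter, ← finProdFinEquiv.sum_comp, Fintype.sum_prod_type]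
  apply Finset.sum_congr rfl
  intro j _
  rw [missing, Finset.card_filter, Finset.sum_range]
  apply Finset.sum_congr rfl
  intro i _
  have : PresentAt x (q * j + i) ↔ Present x (finProdFinEquiv (j, i)) := by
    have e : q * j + i = (finProdFinEquiv (j, i)).val := by simp [finProdFinEquiv]; ring
    rw [e]
    exact ⟨fun ⟨_, h⟩ => h, fun h => ⟨_, h⟩⟩
  simp only [this]

theorem card_absent (i : Fin g) :
    (Finset.univ.filter fun x : Placement g D b => ¬ Present x i).card * D =
      if D = 0 then 0 else Fintype.card (Placement g D b) := by
  rcases Nat.eq_zero_or_pos D with rfl | hD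
  · simp
  rw [if_neg hD.ne']
  have h1 : (Finset.univ.filter fun x : Placement g D b => ¬ Present x i) =
      Fintype.piFinset (Function.update (fun _ => Finset.univ) i
        (Finset.univ.filter fun p : Fin D × Fin b => p.1.val = 0)) := by
    ext x
    simp only [Finset.mem_filter, Finset.mem_univ, true_and, Fintype.mem_piFinset, Present,
      not_not]
    constructor
    · intro h j
      rcases eq_or_ne j i with rfl | hj
      · simpa using h
      · simp [Function.update_of_ne hj]
    · intro h
      simpa using h i
  have h2 : (Finset.univ.filter fun p : Fin D × Fin b => p.1.val = 0) =
      (Finset.univ.filter fun p : Fin D => p.val = 0) ×ˢ Finset.univ := by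
    ext p; simp
  have h3 : ∀ (S : Finset (Fin D × Fin b)) (j : Fin g),
      (Function.update (fun _ => Finset.univ) i S j).card =
        Function.update (fun _ => D * b) i S.card j := by
    intro S j
    rcases eq_or_ne j i with rfl | hj
    · simp
    · simp [Function.update_of_ne hj]
  rw [h1, Fintype.card_piFinset]
  simp only [h3]
  rw [Finset.prod_update_of_mem (Finset.mem_univ i), h2, Finset.card_product, card_zero hD]
  simp only [Finset.card_univ, Fintype.card_fin, one_mul, Fintype.card_pi, Fintype.card_prod]
  rw [← Finset.mul_prod_erase _ _ (Finset.mem_univ i), Finset.sdiff_singleton_eq_erase]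
  ring

/-- Markov's inequality for the number of empty rows. -/
theorem card_many_absent {s : ℕ} :
    (Finset.univ.filter fun x : Placement g D b =>
      g < (Finset.univ.filter fun i => ¬ Present x i).card * s).card * D ≤
      Fintype.card (Placement g D b) * s := by
  classical
  rcases Nat.eq_zero_or_pos g with rfl | hg
  · simp
  set B := Finset.univ.filter fun x : Placement g D b =>
      g < (Finset.univ.filter fun i => ¬ Present x i).card * s
  have h1 : B.card * g ≤
      ∑ x : Placement g D b, (Finset.univ.filter fun i => ¬ Present x i).card * s := by
    rw [← smul_eq_mul]
    refine (Finset.card_nsmul_le_sum B _ g fun x hx => (Finset.mem_filter.1 hx).2.le).trans ?_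
    exact Finset.sum_le_sum_of_subset (Finset.subset_univ _)
  have h2 : (∑ x : Placement g D b, (Finset.univ.filter fun i => ¬ Present x i).card) * D ≤
      g * Fintype.card (Placement g D b) := by
    simp only [Finset.card_filter]
    rw [Finset.sum_comm, Finset.sum_mul]
    simp only [← Finset.card_filter]
    simp only [card_absent, Finset.sum_const, Finset.card_univ, Fintype.card_fin, smul_eq_mul]
    split_ifs <;> simp
  rw [← Finset.sum_mul] at h1
  apply Nat.le_of_mul_le_mul_right _ hg
  calc B.card * D * g = B.card * g * D := by ring
    _ ≤ _ := Nat.mul_le_mul_right D h1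
    _ = (∑ x : Placement g D b, (Finset.univ.filter fun i => ¬ Present x i).card) * D * s := by ring
    _ ≤ _ := Nat.mul_le_mul_right s h2
    _ = _ := by ring

end Instance

end RLZ

namespace RLZ

/-! ### Averaging and union bounds -/

open Classical in
/-- If a random `a` has property `p x` with probability at least `1 / 100` for every `x`, then some
`a` has property `p x` for at least a hundredth of all `x`. -/
theorem exists_mem_support_card_le {X α : Type} [Fintype X] [Nonempty X] (A : PMF α)
    (p : X → α → Prop) (h : ∀ x, 1 / 100 ≤ A.toOuterMeasure {a | p x a}) :
    ∃ a ∈ A.support, Fintype.card X ≤ 100 * (Finset.univ.filter fun x => p x a).card := by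
  by_contra! hcon
  set c : α → ℕ := fun a => (Finset.univ.filter fun x => p x a).card with hc
  have h1 : (Fintype.card X : ENNReal) * (1 / 100) ≤ ∑' a, A a * c a := by
    calc (Fintype.card X : ENNReal) * (1 / 100) = ∑ _x : X, (1 / 100 : ENNReal) := by simp
      _ ≤ ∑ x, A.toOuterMeasure {a | p x a} := Finset.sum_le_sum fun x _ => h x
      _ = ∑ x, ∑' a, A a * (if p x a then 1 else 0) := by
        apply Finset.sum_congr rfl
        intro x _
        rw [PMF.toOuterMeasure_apply]
        apply tsum_congr
        intro a
        simp [Set.indicator_apply]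
      _ = ∑' a, ∑ x, A a * (if p x a then 1 else 0) :=
        (Summable.tsum_finsetSum fun _ _ => ENNReal.summable).symm
      _ = ∑' a, A a * c a := by
        apply tsum_congr
        intro a
        rw [← Finset.mul_sum, hc]
        simp
  -- By integrality the strict inequality leaves room for +1, and averaging preserves it because the
  -- weights sum to 1.
  have h2 : (∑' a, A a * c a) * 100 + 1 ≤ Fintype.card X := by
    calc (∑' a, A a * c a) * 100 + 1 = ∑' a, (A a * c a * 100 + A a) := by
          rw [ENNReal.tsum_add, ENNReal.tsum_mul_right, A.tsum_coe]
      _ ≤ ∑' a, A a * Fintype.card X := by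
        apply ENNReal.tsum_le_tsum
        intro a
        by_cases ha : a ∈ A.support
        · have : (c a * 100 + 1 : ENNReal) ≤ Fintype.card X := by
            have : 100 * c a < Fintype.card X := hcon a ha
            exact_mod_cast (by omega : c a * 100 + 1 ≤ Fintype.card X)
          calc A a * c a * 100 + A a = A a * (c a * 100 + 1) := by ring
            _ ≤ _ := by gcongr
        · rw [PMF.mem_support_iff, not_not] at ha
          simp [ha]
      _ = Fintype.card X := by rw [ENNReal.tsum_mul_right, A.tsum_coe, one_mul]
  have h3 : (Fintype.card X : ENNReal) ≤ (∑' a, A a * c a) * 100 := by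
    calc (Fintype.card X : ENNReal) = Fintype.card X * (1 / 100) * 100 := by
          rw [mul_assoc, one_div, ENNReal.inv_mul_cancel (by norm_num) (by norm_num), mul_one]
      _ ≤ _ := by gcongr
  have hfin : (∑' a, A a * c a) * 100 ≠ ⊤ := by
    intro htop
    rw [htop] at h2
    simp at h2
  exact absurd (h2.trans h3) (not_le.2 (ENNReal.lt_add_right hfin one_ne_zero))

/-- Union bound over the possible starts `i`: each procedure alone is correct on a fraction of at
most exp(-g/(4D)) of the placements, yet together they cover at least 1/200 of them. -/
theorem card_le_of_queryBound {g D b k : ℕ} (hD : 0 < D) (hb : 0 < b) {I : Type} [Fintype I]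
    {f : I → Placement g D b → Finset (Fin g)} (hf : ∀ i, QueryBound k (f i))
    (hk : 16 * k ≤ g * b) (S : Finset (Placement g D b))
    (hS : ∀ x ∈ S, ∃ i, g ≤ 2 * (f i x).card ∧ ∀ r ∈ f i x, Present x r)
    (hcard : Fintype.card (Placement g D b) ≤ 200 * S.card) :
    Real.exp (g / (4 * D)) ≤ 200 * Fintype.card I := by
  classical
  have h1 : S ⊆ Finset.univ.biUnion fun i => Finset.univ.filter fun x : Placement g D b =>
      g ≤ 2 * (f i x).card ∧ ∀ r ∈ f i x, Present x r := by
    intro x hx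
    obtain ⟨i, hi⟩ := hS x hx
    simp only [Finset.mem_biUnion, Finset.mem_univ, true_and, Finset.mem_filter]
    exact ⟨i, hi⟩
  have h2 : (S.card : ℝ) ≤ Fintype.card I *
      (Fintype.card (Placement g D b) * Real.exp (-(g / (4 * D)))) := by
    calc (S.card : ℝ) ≤ ∑ i, ((Finset.univ.filter fun x : Placement g D b =>
          g ≤ 2 * (f i x).card ∧ ∀ r ∈ f i x, Present x r).card : ℝ) := by
          exact_mod_cast (Finset.card_le_card h1).trans Finset.card_biUnion_le
      _ ≤ ∑ _i : I, Fintype.card (Placement g D b) * Real.exp (-(g / (4 * D))) := by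
          apply Finset.sum_le_sum
          intro i _
          convert card_correct_le hD hb (hf i) hk
      _ = _ := by rw [Finset.sum_const, nsmul_eq_mul, Finset.card_univ]
  have h3 : (0 : ℝ) < Fintype.card (Placement g D b) := by
    have : NeZero D := ⟨hD.ne'⟩
    have : NeZero b := ⟨hb.ne'⟩
    exact_mod_cast Fintype.card_pos
  have h4 : (Fintype.card (Placement g D b) : ℝ) ≤ 200 * S.card := by exact_mod_cast hcard
  have h5 : (Fintype.card (Placement g D b) : ℝ) * Real.exp (g / (4 * D)) ≤
      Fintype.card (Placement g D b) * (200 * Fintype.card I) := by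
    calc (Fintype.card (Placement g D b) : ℝ) * Real.exp (g / (4 * D))
        ≤ 200 * (Fintype.card I * (Fintype.card (Placement g D b) *
            Real.exp (-(g / (4 * D))))) * Real.exp (g / (4 * D)) := by
          gcongr; linarith
      _ = Fintype.card (Placement g D b) * (200 * Fintype.card I) *
          (Real.exp (-(g / (4 * D))) * Real.exp (g / (4 * D))) := by ring
      _ = _ := by rw [← Real.exp_add]; simp
  exact le_of_mul_le_mul_left h5 h3

open Classical in
/-- The placements with few empty rows for which the algorithm succeeds. -/
noncomputable def goodPlacements {g b m σ w d e : ℕ} [NeZero σ] (a : Algorithm m σ w d e)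
    (n z φ t : ℕ) : Finset (Placement g (16000 * φ) b) :=
  Finset.univ.filter fun x => a.Succeeds n z φ t (reference m σ (80 * φ) x) ∧
    (Finset.univ.filter fun i => ¬ Present x i).card * (80 * φ) ≤ g

theorem exists_card_goodPlacements {m σ w d e : ℕ} [NeZero σ] (g b : ℕ)
    (A : PMF (Algorithm m σ w d e)) {n z φ t : ℕ} (hφ : 0 < φ) (hb : 0 < b)
    (h : ∀ R : Fin m → Fin σ, 1 / 100 ≤ A.toOuterMeasure {a | a.Succeeds n z φ t R}) :
    ∃ a ∈ A.support, Fintype.card (Placement g (16000 * φ) b) ≤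
      200 * (goodPlacements a n z φ t : Finset (Placement g (16000 * φ) b)).card := by
  classical
  have : NeZero φ := ⟨hφ.ne'⟩
  have : NeZero b := ⟨hb.ne'⟩
  obtain ⟨a, ha, h1⟩ := exists_mem_support_card_le A
    (fun (x : Placement g (16000 * φ) b) a => a.Succeeds n z φ t (reference m σ (80 * φ) x))
    fun x => h _
  refine ⟨a, ha, ?_⟩
  have h2 := card_many_absent (g := g) (D := 16000 * φ) (b := b) (s := 80 * φ)
  set B := Finset.univ.filter fun x : Placement g (16000 * φ) b =>
      g < (Finset.univ.filter fun i => ¬ Present x i).card * (80 * φ) with hB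
  have h3 : (Finset.univ.filter fun x : Placement g (16000 * φ) b =>
      a.Succeeds n z φ t (reference m σ (80 * φ) x)) ⊆ goodPlacements a n z φ t ∪ B := by
    intro x hx
    simp only [goodPlacements, hB, Finset.mem_union, Finset.mem_filter, Finset.mem_univ,
      true_and] at hx ⊢
    by_cases h : g < (Finset.univ.filter fun i => ¬ Present x i).card * (80 * φ)
    · exact Or.inr h
    · exact Or.inl ⟨hx, not_lt.1 h⟩
  have h4 := (Finset.card_le_card h3).trans (Finset.card_union_le _ _)
  -- The bad fraction is 80φ/(16000φ) = 1/200, half of the success fraction 1/100.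
  have h5 : 200 * B.card ≤ Fintype.card (Placement g (16000 * φ) b) := by
    apply Nat.le_of_mul_le_mul_right _ (show 0 < 80 * φ by omega)
    calc 200 * B.card * (80 * φ) = B.card * (16000 * φ) := by ring
      _ ≤ _ := h2
  omega

/-! ### Runs on the hard texts -/

section Runs

variable {g b m σ w d e n z φ t q K : ℕ} [NeZero σ]

/-- What success of the algorithm means for the hard texts. -/
theorem exists_output {a : Algorithm m σ w d e} {D : ℕ} {x : Placement g D b}
    (ha : a.Succeeds n z φ t (reference m σ (80 * φ) x))
    (hm : 2 * (g * b * (80 * φ)) ≤ m) (hσ : 2 + g * (80 * φ) ≤ σ) (hm0 : 0 < m)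
    (hb : 0 < b) (hφ : 0 < φ) (hK : 0 < K) (hq : 0 < q)
    (hKq : K * q ≤ z) (hz : z ≤ 2 * (K * q)) (hn : 100 * z * φ ≤ n) (hnz : n ≤ z * m) (o : ℕ) :
    ∃ out : List ℕ,
      (∀ s, t ≤ s → (evolve a.program (reference m σ (80 * φ) x) s
        (a.start (reference m σ (80 * φ) x) (text n σ (80 * φ) q (n / K) o))).out = out) ∧
      IsRFactorization (List.ofFn (reference m σ (80 * φ) x))
        (List.ofFn (text n σ (80 * φ) q (n / K) o)) out ∧
      out.length ≤ φ * (7 * z + K * (missing x o q * (80 * φ))) ∧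
      q * (80 * φ + 2) ≤ n / K := by
  have hu : q * (80 * φ + 2) ≤ n / K := by
    rw [Nat.le_div_iff_mul_le hK]
    calc q * (80 * φ + 2) * K = K * q * (80 * φ + 2) := by ring
      _ ≤ z * (80 * φ + 2) := Nat.mul_le_mul_right _ hKq
      _ ≤ z * (100 * φ) := Nat.mul_le_mul_left _ (by omega)
      _ = 100 * z * φ := by ring
      _ ≤ n := hn
  have hL : 0 < 80 * φ := by omega
  have h1 := length_rlz_le_missing (σ := σ) (o := o) hm hm0 hL hb hK hq hKq hnz hu x
  have h2 := le_length_rlz (m := m) (o := o) hσ hL hu (Nat.mul_div_le n K) hz x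
  have h3 : missing x o q ≤ q := by
    classical
    exact (Finset.card_filter_le _ _).trans (by simp)
  -- Even if all rows were empty, the greedy size would stay within the promised range, so the
  -- algorithm must handle every placement.
  have h4 : 7 * z + K * (missing x o q * (80 * φ)) ≤ 100 * z * φ := by
    calc 7 * z + K * (missing x o q * (80 * φ)) ≤ 7 * z + K * (q * (80 * φ)) := by gcongr
      _ = 7 * z + K * q * (80 * φ) := by ring
      _ ≤ 7 * z + z * (80 * φ) := by gcongr
      _ ≤ 7 * (z * φ) + z * (80 * φ) := by
        have := Nat.le_mul_of_pos_right z hφ; omega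
      _ = 87 * (z * φ) := by ring
      _ ≤ 100 * (z * φ) := by omega
      _ = _ := by ring
  obtain ⟨out, ho1, ho2, ho3⟩ := ha (text n σ (80 * φ) q (n / K) o) h2 (h1.trans h4)
  exact ⟨out, fun s hs => out_evolve_of_outputWithin ho1 hs, ho2,
    ho3.trans (Nat.mul_le_mul_left _ h1), hu⟩

/-- Few queries per period: every text contains each of its blocks once, and the machine is run on
all texts. -/
theorem short_texts {J : ℕ} {a : Algorithm m σ w d e} (hm : 2 * (J * z * b * (80 * φ)) ≤ m)
    (hσ : 2 + J * z * (80 * φ) ≤ σ) (hm0 : 0 < m) (hb : 0 < b) (hφ : 0 < φ) (hz : 0 < z)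
    (hn : 100 * z * φ ≤ n) (hnz : n ≤ z * m) (ht : 16 * (J * t) ≤ J * z * b)
    (hcard : Fintype.card (Placement (J * z) (16000 * φ) b) ≤
      200 * (goodPlacements a n z φ t : Finset (Placement (J * z) (16000 * φ) b)).card) :
    Real.exp (((J * z : ℕ) : ℝ) / (4 * (16000 * φ : ℕ))) ≤
      200 * Fintype.card (Fin d → BitVec w) := by
  set L := 80 * φ with hLdef
  -- The additional memory starts with zeros, so guessing the data structure alone fixes all `J`
  -- runs.
  let start : (Fin d → BitVec w) → Fin J → Config σ w (d + e) := fun mem j =>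
    { pc := 0, mem := Fin.append mem (fun _ : Fin e => 0),
      text := List.ofFn (text n σ L z (n / 1) (z * j)), out := [] }
  refine card_le_of_queryBound (k := J * t) (by omega) hb
    (f := fun mem x => named L z fun j =>
      (evolve a.program (reference m σ L x) t (start mem j)).out) ?_ ht _ ?_ hcard
  · intro mem
    exact (QueryBound.pi fun j =>
      (queryBound_evolve a.program (queryBound_reference hb) t (start mem j)).map
        Config.out).map (named L z)
  · intro x hx
    simp only [goodPlacements, Finset.mem_filter, Finset.mem_univ, true_and] at hx
    obtain ⟨hsucc, habs⟩ := hx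
    refine ⟨a.preprocess (reference m σ L x), ?_⟩
    have hex := fun j : Fin J => exists_output (K := 1) (q := z) hsucc hm hσ hm0 hb hφ one_pos hz
      (by omega) (by omega) hn hnz (z * j)
    choose out h1 h2 h3 h4 using hex
    have h5 : (fun j => (evolve a.program (reference m σ L x) t
        (start (a.preprocess (reference m σ L x)) j)).out) = out :=
      funext fun j => h1 j t le_rfl
    simp only [h5]
    constructor
    · rw [card_named]
      have h6 : ∀ j ∈ (Finset.univ : Finset (Fin J)), z * L ≤
          φ * (7 * z) + φ * (missing x (z * j) z * L) + (touched L z (out j)).card * L := by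
        intro j _
        have hs := (h2 j).sum_eq
        rw [List.length_ofFn] at hs
        have h7 := mul_le_length_add_touched L z (ls := out j) (by
          rw [hs]; simpa using h4 j)
        have := h3 j
        rw [one_mul, mul_add, ← hLdef] at this
        omega
      have h8 := Finset.sum_le_sum h6
      simp only [Finset.sum_add_distrib, Finset.sum_const, Finset.card_univ, Fintype.card_fin,
        smul_eq_mul] at h8
      rw [← Finset.mul_sum, ← Finset.sum_mul, ← Finset.sum_mul, sum_missing] at h8
      set N := ∑ j, (touched L z (out j)).card
      have h9 : φ * ((Finset.univ.filter fun i => ¬ Present x i).card * L) ≤ φ * (J * z) :=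
        Nat.mul_le_mul_left _ habs
      -- Dividing by φ, all outputs together have at most 8Jz phrases, against 80Jz block symbols.
      have h10 : 80 * (J * z) ≤ 8 * (J * z) + 80 * N := by
        apply Nat.le_of_mul_le_mul_left _ hφ
        calc φ * (80 * (J * z)) = J * (z * L) := by rw [hLdef]; ring
          _ ≤ _ := h8
          _ ≤ J * (φ * (7 * z)) + φ * (J * z) + N * L := by omega
          _ = _ := by rw [hLdef]; ring
      omega
    · intro r hr
      simp only [named, Finset.mem_map, Finset.mem_filter, Finset.mem_univ, true_and,
        Equiv.coe_toEmbedding] at hr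
      obtain ⟨⟨j, i⟩, hi, rfl⟩ := hr
      simp only [touched, Finset.mem_filter, Finset.mem_range] at hi
      obtain ⟨hiz, o, ho, hc⟩ := hi
      have hj : z * j + z ≤ J * z := by
        have : z * (j + 1) ≤ z * J := Nat.mul_le_mul_left z j.isLt
        linarith
      obtain ⟨h, hp⟩ := presentAt_of_covered (ls := []) (k := 0) hσ (by omega) (h4 j) hj (h2 j)
        (by simp) hiz ho hc
      have e : (⟨z * j + i, h⟩ : Fin (J * z)) = finProdFinEquiv (j, i) :=
        Fin.ext (by simp [finProdFinEquiv]; ring)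
      rwa [e] at hp

/-- Averaging with steps weighted by 16l and phrases by τ: a round that violates either bound has
weight above τl, and the total weight is at most Kτl. -/
theorem exists_short_round {K t N τ l : ℕ} {s o : ℕ → ℕ} (hs : Monotone s) (ho : Monotone o)
    (hsK : s K ≤ t) (hoK : o K ≤ N) (hτ : 0 < τ) (hl : 0 < l)
    (h : 16 * (t * l) + N * τ ≤ K * (τ * l)) (hK : 0 < K) :
    ∃ k < K, 16 * (s (k + 1) - s k) ≤ τ ∧ o (k + 1) - o k ≤ l := by
  by_contra! hcon
  have h1 : ∀ k ∈ Finset.range K,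
      τ * l < 16 * ((s (k + 1) - s k) * l) + (o (k + 1) - o k) * τ := by
    intro k hk
    by_cases h2 : 16 * (s (k + 1) - s k) ≤ τ
    · have h3 : l < o (k + 1) - o k := hcon k (Finset.mem_range.1 hk) h2
      have : l * τ < (o (k + 1) - o k) * τ := Nat.mul_lt_mul_of_pos_right h3 hτ
      rw [mul_comm τ l]; omega
    · have : τ * l < 16 * (s (k + 1) - s k) * l := Nat.mul_lt_mul_of_pos_right (not_le.1 h2) hl
      rw [← mul_assoc]; omega
  have h2 := Finset.sum_lt_sum_of_nonempty (Finset.nonempty_range_iff.2 hK.ne') h1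
  rw [Finset.sum_const, Finset.card_range, smul_eq_mul, Finset.sum_add_distrib, ← Finset.mul_sum,
    ← Finset.sum_mul, ← Finset.sum_mul, Finset.sum_range_tsub hs, Finset.sum_range_tsub ho] at h2
  have h3 : (s K - s 0) * l ≤ t * l := Nat.mul_le_mul_right _ (by omega)
  have h4 : (o K - o 0) * τ ≤ N * τ := Nat.mul_le_mul_right _ (by omega)
  omega

/-- Some period of the text is processed quickly and with few phrases. The output in this period is
determined by the content of the memory, the instruction address, the position in the period, and
the number of remaining symbols (up to the number of steps). -/
theorem exists_round {a : Algorithm m σ w d e} {D τ : ℕ} {x : Placement g D b} {out : List ℕ}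
    {L u : ℕ} (hL : 0 < L) (hσ : 2 + g * L ≤ σ) (hq : 0 < q) (hu : q * (L + 2) ≤ u)
    (hout : ∀ s, t ≤ s → (evolve a.program (reference m σ L x) s
        (a.start (reference m σ L x) (text n σ L q u 0))).out = out)
    (hf : IsRFactorization (List.ofFn (reference m σ L x)) (List.ofFn (text n σ L q u 0)) out)
    (hKn : K * u ≤ n) (hK : 0 < K) {l N : ℕ} (hl : 0 < l) (hN : out.length ≤ N) (hτ : 16 ≤ τ)
    (h : 16 * (t * l) + N * τ ≤ K * (τ * l)) :
    ∃ (k pc v r : ℕ) (mem : Fin (d + e) → BitVec w) (o₁ o₂ o₃ : List ℕ),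
      pc ≤ a.program.length ∧ v < u ∧ r ≤ τ / 16 ∧
      (evolve a.program (reference m σ L x) (τ / 16) (Config.mk (σ := σ) pc mem
        (seg (textSeq σ L q u 0) v r) [])).out = o₂ ++ o₃ ∧
      o₁ ++ (o₂ ++ o₃) <+: out ∧ o₁.sum = k * u ∧ o₂.sum = u ∧ o₂.length ≤ l := by
  set R := reference m σ L x with hR
  set T := text n σ L q u 0 with hT
  set P := a.program
  let c : ℕ → Config σ w (d + e) := fun s => evolve P R s (a.start R T)
  have hu0 : 0 < u := lt_of_lt_of_le (by positivity) hu
  have hpre : ∀ s s', s ≤ s' → (c s).out <+: (c s').out := fun s s' hs => out_prefix_evolve P R _ hs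
  have hpre' : ∀ s, (c s).out <+: out := fun s => by
    rw [← hout (max s t) (le_max_right _ _)]
    exact hpre _ _ (le_max_left _ _)
  have hsum : out.sum = n := by simpa using hf.sum_eq
  have hex : ∀ k, ∃ s, (k ≤ K → k * u ≤ (c s).out.sum) := fun k => ⟨t, fun hk => by
    rw [hout t le_rfl, hsum]
    exact (Nat.mul_le_mul_right u hk).trans hKn⟩
  -- The first time at which the output covers `k` periods; capping at `K` keeps it defined and
  -- monotone for all `k`.
  let s : ℕ → ℕ := fun k => Nat.find (hex (min k K))
  have hs_spec : ∀ k ≤ K, k * u ≤ (c (s k)).out.sum := fun k hk => by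
    have : min k K * u ≤ (c (s k)).out.sum :=
      Nat.find_spec (hex (min k K)) (min_le_right _ _)
    rwa [min_eq_left hk] at this
  have hs_le : ∀ k, s k ≤ t := fun k => by
    apply Nat.find_min'
    intro hk
    rw [hout t le_rfl, hsum]
    exact (Nat.mul_le_mul_right u hk).trans hKn
  have hs_mono : Monotone s := fun k k' hk => by
    apply Nat.find_min'
    intro _
    have := Nat.find_spec (hex (min k' K)) (min_le_right _ _)
    exact (Nat.mul_le_mul_right u (min_le_min_right K hk)).trans this
  -- The output reaches the boundary exactly: the last emitted phrase started before it and cannot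
  -- cross it.
  have hs_eq : ∀ k ≤ K, (c (s k)).out.sum = k * u := fun k hk => by
    refine le_antisymm ?_ (hs_spec k hk)
    rcases Nat.eq_zero_or_pos (s k) with h0 | h0
    · rw [h0]; simp [c, evolve_zero, Algorithm.start]
    · obtain ⟨s', hs'⟩ : ∃ s', s k = s' + 1 := ⟨s k - 1, by omega⟩
      have hlt : (c s').out.sum < k * u := by
        have := Nat.find_min (hex (min k K)) (m := s') (by
          change s' < s k; omega)
        push Not at this
        rw [min_eq_left hk] at this
        exact this.2
      have hstep : c (s' + 1) = advance P R (c s') := evolve_succ' _ _ _ _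
      rw [hs', hstep]
      rcases out_advance P R (c s') with h | ⟨l, h⟩
      · rw [h]; exact hlt.le
      · obtain ⟨rest, hrest⟩ := hpre' (s' + 1)
        rw [hstep, h, List.append_assoc, List.singleton_append] at hrest
        rw [← hrest] at hf
        have := not_crossing hσ hL hq hu hf hlt
        rw [h, List.sum_append]
        simpa using this
  obtain ⟨k, hk, h1, h2⟩ := exists_short_round (o := fun k => (c (s k)).out.length) hs_mono
    (fun k k' hk => (hpre _ _ (hs_mono hk)).length_le) (hs_le K)
    ((hpre' _).length_le.trans hN) (by omega) hl h hK
  obtain ⟨o₂, ho₂⟩ := hpre _ _ (hs_mono (Nat.le_succ k))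
  obtain ⟨p, hp⟩ : ∃ p, (c (s k)).text = (List.ofFn T).drop p :=
    ⟨_, (List.suffix_iff_eq_drop.1 (text_suffix_evolve P R (a.start R T) (s k)))⟩
  -- The computation is restarted from a configuration with few possible values. By periodicity the
  -- unread text matters only through its position modulo `u` and its length capped at the number of
  -- steps; instruction addresses beyond the program all mean halting.
  have hag : Agree P (c (s k)).out (τ / 16) (c (s k))
      (Config.mk (σ := σ) (min (c (s k)).pc P.length) (c (s k)).mem
        (seg (textSeq σ L q u 0) (p % u) (min (τ / 16) (n - p))) []) := by
    refine ⟨by simp, ?_⟩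
    by_cases hpc : (c (s k)).pc ≤ P.length
    · refine Or.inl ⟨(min_eq_left hpc).symm, rfl, ?_⟩
      rw [hp, hT, ofFn_text, seg_drop, seg_take, seg_take]
      simp only [zero_add]
      rw [min_eq_right (min_le_left (τ / 16) (n - p))]
      apply seg_congr
      intro j _
      conv_lhs => rw [← Nat.div_add_mod p u, mul_comm u, add_assoc]
      exact textSeq_period _ _ _ _ _ _
    · exact Or.inr ⟨by omega, by simp; omega⟩
  have hev := hag.evolve R
  have hadd : evolve P R (τ / 16) (c (s k)) = c (τ / 16 + s k) := (evolve_add _ _ _ _ _).symm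
  have hle : s (k + 1) ≤ τ / 16 + s k := by omega
  obtain ⟨o₃, ho₃⟩ := hpre _ _ hle
  rw [← hadd, hev, ← ho₂, List.append_assoc, List.append_cancel_left_eq] at ho₃
  refine ⟨k, min (c (s k)).pc P.length, p % u, min (τ / 16) (n - p), (c (s k)).mem,
    (c (s k)).out, o₂, o₃, min_le_right _ _, Nat.mod_lt _ hu0, min_le_left _ _, ho₃.symm, ?_,
    hs_eq k hk.le, ?_, ?_⟩
  · rw [ho₃, ← hev, hadd]
    exact hpre' _
  · have h3 := congrArg List.sum ho₂
    rw [List.sum_append, hs_eq k hk.le, hs_eq (k + 1) hk, Nat.succ_mul] at h3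
    omega
  · have h3 := congrArg List.length ho₂
    rw [List.length_append] at h3
    simp only [Nat.succ_eq_add_one] at h3
    omega

/-- Many periods: every period contains all blocks. -/
theorem long_text {a : Algorithm m σ w d e} (hm : 2 * (1 * q * b * (80 * φ)) ≤ m)
    (hσ : 2 + 1 * q * (80 * φ) ≤ σ) (hm0 : 0 < m) (hb : 0 < b) (hφ : 0 < φ) (hK : 0 < K)
    (hq : 16 ≤ q) (hKq : K * q ≤ z) (hz : z ≤ 2 * (K * q)) (hn : 100 * z * φ ≤ n)
    (hnz : n ≤ z * m) (ht : 32 * t ≤ K * (q * b))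
    (hcard : Fintype.card (Placement (1 * q) (16000 * φ) b) ≤
      200 * (goodPlacements a n z φ t : Finset (Placement (1 * q) (16000 * φ) b)).card) :
    Real.exp (((1 * q : ℕ) : ℝ) / (4 * (16000 * φ : ℕ))) ≤
      200 * Fintype.card ((Fin (d + e) → BitVec w) × Fin (a.program.length + 1) × Fin (n / K) ×
        Fin (q * b / 16 + 1)) := by
  set L := 80 * φ with hLdef
  set u := n / K with hudef
  let start : (Fin (d + e) → BitVec w) × Fin (a.program.length + 1) × Fin u ×
        Fin (q * b / 16 + 1) → Config σ w (d + e) := fun i =>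
    { pc := i.2.1, mem := i.1, text := seg (textSeq σ L q u 0) i.2.2.1 i.2.2.2, out := [] }
  refine card_le_of_queryBound (k := 1 * (q * b / 16)) (by omega) hb
    (f := fun i x => named L q fun _ : Fin 1 =>
      (evolve a.program (reference m σ L x) (q * b / 16) (start i)).out) ?_
      (by rw [one_mul, one_mul]; exact Nat.mul_div_le _ _) _ ?_ hcard
  · intro i
    exact (QueryBound.pi fun _ : Fin 1 =>
      (queryBound_evolve a.program (queryBound_reference hb) _ (start i)).map
        Config.out).map (named L q)
  · intro x hx
    simp only [goodPlacements, Finset.mem_filter, Finset.mem_univ, true_and] at hx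
    obtain ⟨hsucc, habs⟩ := hx
    obtain ⟨out, h1, h2, h3, h4⟩ := exists_output (K := K) (q := q) hsucc hm hσ hm0 hb hφ hK
      (by omega) hKq hz hn hnz 0
    rw [← hLdef] at h1 h2 h3 h4
    rw [← hudef] at h4
    have h5 : out.length ≤ 8 * φ * z := by
      refine h3.trans ?_
      have hmiss : missing x 0 q * L ≤ 1 * q := by
        refine le_trans ?_ habs
        rw [← sum_missing]
        simp [hLdef]
      calc φ * (7 * z + K * (missing x 0 q * L)) ≤ φ * (7 * z + K * (1 * q)) := by gcongr
        _ ≤ φ * (7 * z + z) := by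
          rw [one_mul]; gcongr
        _ = _ := by ring
    have hb' : 1 ≤ b := hb
    -- The step bound contributes 20 and the phrase bound 16 times Kφq²b, within the allowance of
    -- 40. The limit l = 40φq is half of the qL block symbols of a period.
    have h6 : 16 * (t * (40 * φ * q)) + 8 * φ * z * (q * b) ≤ K * (q * b * (40 * φ * q)) := by
      calc 16 * (t * (40 * φ * q)) + 8 * φ * z * (q * b)
          = 20 * φ * q * (32 * t) + 8 * φ * (q * b) * z := by ring
        _ ≤ 20 * φ * q * (K * (q * b)) + 8 * φ * (q * b) * (2 * (K * q)) := by gcongr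
        _ = K * (q * b * (36 * φ * q)) := by ring
        _ ≤ _ := by gcongr; omega
    obtain ⟨k, pc, v, r, mem, o₁, o₂, o₃, hpc, hv, hr, hev, hpre, ho₁, ho₂, hlen⟩ :=
      exists_round (K := K) (by omega) hσ (by omega) h4 h1 h2 (Nat.mul_div_le n K) hK
        (l := 40 * φ * q) (by positivity) h5 (by nlinarith : 16 ≤ q * b) h6
    refine ⟨(mem, ⟨pc, by omega⟩, ⟨v, hv⟩, ⟨r, by omega⟩), ?_⟩
    have h7 : (evolve a.program (reference m σ L x) (q * b / 16)
      (start (mem, ⟨pc, by omega⟩, ⟨v, hv⟩, ⟨r, by omega⟩))).out = o₂ ++ o₃ := hev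
    simp only [h7]
    constructor
    · rw [card_named]
      have h8 := mul_le_length_add_touched L q (ls := o₂) (by rw [ho₂]; exact h4)
      have h9 := Finset.card_le_card (touched_append L q o₂ o₃)
      simp only [Finset.sum_const, Finset.card_univ, Fintype.card_fin, one_smul, one_mul]
      set N := (touched L q o₂).card
      have h10 : 80 * q ≤ 40 * q + 80 * N := by
        apply Nat.le_of_mul_le_mul_left _ hφ
        calc φ * (80 * q) = q * L := by rw [hLdef]; ring
          _ ≤ _ := h8
          _ ≤ 40 * φ * q + N * L := by omega
          _ = _ := by rw [hLdef]; ring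
      omega
    · intro r' hr'
      simp only [named, Finset.mem_map, Finset.mem_filter, Finset.mem_univ, true_and,
        Equiv.coe_toEmbedding] at hr'
      obtain ⟨⟨j, i⟩, hi, rfl⟩ := hr'
      simp only [touched, Finset.mem_filter, Finset.mem_range] at hi
      obtain ⟨hiq, o, ho, hc⟩ := hi
      obtain ⟨rest, hrest⟩ := hpre
      rw [List.append_assoc] at hrest
      rw [← hrest] at h2
      obtain ⟨h, hp⟩ := presentAt_of_covered hσ (by omega) h4 (by omega) h2 ho₁ hiq ho hc.append
      have e : (⟨0 + i, h⟩ : Fin (1 * q)) = finProdFinEquiv (j, i) :=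
        Fin.ext (by simp [finProdFinEquiv])
      rwa [e] at hp

end Runs

end RLZ

/-! ### Choice of parameters and conclusion. -/

namespace RLZ

/-- Since e ≥ 2, the left side is at least 2^((C+16)S), whereas 200 < 2^8 and nine spare multiples
of S ≥ 1 make the right side smaller. -/
theorem not_exp_le {C S φ g N : ℕ} (hS : 1 ≤ S) (hφ : 0 < φ)
    (hg : 64000 * (C + 16) * φ * S ≤ g) (hN : N ≤ 2 ^ ((C + 7) * S))
    (h : Real.exp ((g : ℝ) / (4 * (16000 * φ : ℕ))) ≤ 200 * N) : False := by
  have hφ' : (0 : ℝ) < φ := by exact_mod_cast hφ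
  have h1 : (((C + 16) * S : ℕ) : ℝ) ≤ (g : ℝ) / (4 * (16000 * φ : ℕ)) := by
    rw [le_div_iff₀ (by positivity)]
    have : (64000 * (C + 16) * φ * S : ℝ) ≤ g := by exact_mod_cast hg
    push_cast
    linarith
  have h2 : (2 : ℝ) ^ ((C + 16) * S) ≤ Real.exp (((C + 16) * S : ℕ) : ℝ) := by
    rw [← mul_one ((((C + 16) * S : ℕ)) : ℝ), Real.exp_nat_mul]
    apply pow_le_pow_left₀ (by norm_num)
    have := Real.add_one_le_exp (1 : ℝ)
    linarith
  have h3 : (2 : ℝ) ^ ((C + 16) * S) ≤ 200 * N := h2.trans ((Real.exp_le_exp.2 h1).trans h)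
  have h4 : 2 ^ ((C + 16) * S) ≤ 200 * N := by exact_mod_cast h3
  have h5 : 256 * 2 ^ ((C + 7) * S) ≤ 2 ^ ((C + 16) * S) := by
    calc 256 * 2 ^ ((C + 7) * S) = 2 ^ (8 + (C + 7) * S) := by rw [pow_add]; norm_num
      _ ≤ _ := Nat.pow_le_pow_right (by norm_num) (by nlinarith)
  have h6 : 0 < 2 ^ ((C + 7) * S) := by positivity
  omega

end RLZ

/-- Here `C` bounds the constants hidden in the word-width `O(log m)` and in the program size, and
`ε` makes the requirement `S = o(m / φ²)` explicit. A randomized algorithm is a probability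
distribution over deterministic ones. -/
theorem mainTheorem12 :
    ∀ C : ℕ, ∃ ε c : ℝ, 0 < ε ∧ 0 < c ∧
      ∀ n m z φ : ℕ, 0 < n → 0 < m → 0 < z → 0 < φ →
        100 * z * φ ≤ n → n ≤ z * m →
      -- the word-width `w` and the alphabet size `σ`
      ∀ w σ : ℕ, m < 2 ^ w → (w : ℝ) ≤ C * Real.logb 2 m →
        m ≤ σ → σ ≤ 2 ^ w →
      -- the space bound: at most `S` bits for the data structure (`d` words), and at most `S` bits
      -- of additional space (`e` words)
      ∀ S d e : ℕ, w ≤ S → d * w ≤ S → e * w ≤ S →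
        (S : ℝ) ≤ ε * ((m : ℝ) / (φ : ℝ) ^ 2) →
      ∀ A : PMF (RLZ.Algorithm m σ w d e),
        (∀ a ∈ A.support, a.program.length ≤ m ^ C) →
      ∀ t : ℕ,
        (∀ R : Fin m → Fin σ, 1 / 100 ≤ A.toOuterMeasure {a | a.Succeeds n z φ t R}) →
        c * (((z : ℝ) * m) / ((φ : ℝ) ^ 2 * S)) ≤ t := by
  intro C
  set G : ℕ := 64000 * (C + 16) with hG
  have hG0 : 0 < G := by omega
  have hG1 : (0 : ℝ) < G := by exact_mod_cast hG0
  refine ⟨1 / (320 * G), 1 / (40960 * G), by positivity, by positivity, ?_⟩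
  intro n m z φ _ hm hz hφ hn hnz w σ hmw _ hmσ _ S d e hwS hdS heS hS A hA t ht
  have hw : 1 ≤ w := by
    rcases Nat.eq_zero_or_pos w with rfl | h
    · simp at hmw; omega
    · exact h
  have hS1 : 1 ≤ S := hw.trans hwS
  have : NeZero σ := ⟨by omega⟩
  set X := G * φ ^ 2 * S with hX
  have hX0 : 0 < X := by positivity
  have hφ1 : (0 : ℝ) < φ := by exact_mod_cast hφ
  have hS2 : (0 : ℝ) < S := by exact_mod_cast hS1
  have hXm : 320 * X ≤ m := by
    have : (320 * X : ℝ) ≤ m := by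
      rw [hX]
      push_cast
      rw [div_mul_div_comm, one_mul, le_div_iff₀ (by positivity)] at hS
      linarith
    exact_mod_cast this
  by_contra! hcon
  have hneg : 40960 * X * t < z * m := by
    have : (40960 * X * t : ℝ) < z * m := by
      rw [hX]
      push_cast
      rw [div_mul_div_comm, one_mul, lt_div_iff₀ (by positivity)] at hcon
      linarith
    exact_mod_cast this
  set g₀ := G * φ * S with hg₀
  have hg₀X : g₀ * φ = X := by rw [hg₀, hX]; ring
  have hg₀0 : 64000 ≤ g₀ := by
    calc 64000 ≤ G := by omega
      _ ≤ G * φ := Nat.le_mul_of_pos_right _ hφ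
      _ ≤ g₀ := Nat.le_mul_of_pos_right _ hS1
  -- the choice of the number of slots for `g` rows
  have hslots : ∀ g, 0 < g → g ≤ 2 * g₀ → ∃ b, 0 < b ∧ 2 * (g * b * (80 * φ)) ≤ m ∧
      2 + g * (80 * φ) ≤ σ ∧ m ≤ 320 * (g * φ) * b := by
    intro g hg hgg
    have h1 : 2 * (g * (80 * φ)) ≤ m := by
      refine le_trans ?_ hXm
      have h1 := Nat.mul_le_mul_right φ hgg
      have e1 : 2 * (g * (80 * φ)) = 160 * (g * φ) := by ring
      have e2 : 2 * g₀ * φ = 2 * (g₀ * φ) := by ring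
      omega
    have h0 : 0 < 2 * (g * (80 * φ)) := by positivity
    have hb : 0 < m / (2 * (g * (80 * φ))) := Nat.div_pos h1 h0
    refine ⟨m / (2 * (g * (80 * φ))), hb, ?_, ?_, ?_⟩
    · have := Nat.mul_div_le m (2 * (g * (80 * φ)))
      calc _ = 2 * (g * (80 * φ)) * (m / (2 * (g * (80 * φ)))) := by ring
        _ ≤ m := this
    · have : 1 ≤ g * φ := Nat.mul_pos hg hφ
      have e : g * (80 * φ) = 80 * (g * φ) := by ring
      omega
    -- As the quotient is positive, rounding down loses at most a factor 2, which turns 160 into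
    -- 320.
    · have h2 := Nat.lt_div_mul_add h0 (a := m)
      set b := m / (2 * (g * (80 * φ)))
      have h3 : 2 * (g * (80 * φ)) ≤ b * (2 * (g * (80 * φ))) := Nat.le_mul_of_pos_left _ hb
      have e : 320 * (g * φ) * b = b * (2 * (g * (80 * φ))) + b * (2 * (g * (80 * φ))) := by ring
      omega
  have hcardBV : Fintype.card (BitVec w) = 2 ^ w := by
    rw [Fintype.card_congr BitVec.equivFin.toEquiv, Fintype.card_fin]
  rcases lt_or_ge z g₀ with hzg | hzg
  -- A text has fewer blocks than the required number of rows. Rounding up gives g₀ ≤ Jz ≤ 2g₀.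
  · set J := g₀ / z + 1 with hJ
    have h1 : g₀ ≤ J * z := by
      have := Nat.lt_div_mul_add hz (a := g₀)
      rw [hJ, Nat.succ_mul]; omega
    have h2 : J * z ≤ 2 * g₀ := by
      have := Nat.div_mul_le_self g₀ z
      rw [hJ, Nat.succ_mul]; omega
    obtain ⟨b, hb, hbm, hσ, hmb⟩ := hslots (J * z) (by omega) h2
    obtain ⟨a, ha, hcard⟩ := RLZ.exists_card_goodPlacements (J * z) b A hφ hb ht
    have htb : 16 * t ≤ z * b := by
      have : 64 * t < z * b := by
        apply Nat.lt_of_mul_lt_mul_left (a := 640 * X)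
        calc 640 * X * (64 * t) = 40960 * X * t := by ring
          _ < z * m := hneg
          _ ≤ z * (320 * (J * z * φ) * b) := Nat.mul_le_mul_left _ hmb
          _ ≤ z * (320 * (2 * g₀ * φ) * b) := by gcongr
          _ = 640 * (g₀ * φ) * (z * b) := by ring
          _ = _ := by rw [hg₀X]
      omega
    have h3 := RLZ.short_texts (a := a) hbm hσ hm hb hφ hz hn hnz (by
      calc 16 * (J * t) = J * (16 * t) := by ring
        _ ≤ J * (z * b) := Nat.mul_le_mul_left _ htb
        _ = J * z * b := by ring) hcard
    refine RLZ.not_exp_le (C := C) hS1 hφ (by rw [← hG]; exact h1) ?_ h3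
    rw [Fintype.card_fun, hcardBV, Fintype.card_fin, ← pow_mul, mul_comm w d]
    exact Nat.pow_le_pow_right (by norm_num) (hdS.trans (Nat.le_mul_of_pos_left _ (by omega)))
  -- All g₀ rows fit into one period, and rounding down keeps K g₀ between z/2 and z.
  · set K := z / g₀ with hK
    have hK0 : 0 < K := Nat.div_pos hzg (by omega)
    have h1 : K * g₀ ≤ z := Nat.div_mul_le_self _ _
    have h2 : z ≤ 2 * (K * g₀) := by
      have : z < K * g₀ + g₀ := Nat.lt_div_mul_add (show 0 < g₀ by omega)
      have : g₀ ≤ K * g₀ := Nat.le_mul_of_pos_left _ hK0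
      omega
    obtain ⟨b, hb, hbm, hσ, hmb⟩ := hslots (1 * g₀) (by omega) (by omega)
    obtain ⟨a, ha, hcard⟩ := RLZ.exists_card_goodPlacements (1 * g₀) b A hφ hb ht
    have htb : 32 * t ≤ K * (g₀ * b) := by
      have : 64 * t < K * (g₀ * b) := by
        apply Nat.lt_of_mul_lt_mul_left (a := 640 * X)
        calc 640 * X * (64 * t) = 40960 * X * t := by ring
          _ < z * m := hneg
          _ ≤ 2 * (K * g₀) * (320 * (1 * g₀ * φ) * b) := Nat.mul_le_mul h2 hmb
          _ = 640 * (g₀ * φ) * (K * (g₀ * b)) := by ring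
          _ = _ := by rw [hg₀X]
      omega
    have h3 := RLZ.long_text (a := a) hbm hσ hm hb hφ hK0 (by omega) h1 h2 hn hnz htb hcard
    refine RLZ.not_exp_le (C := C) hS1 hφ (by rw [← hG, one_mul]) ?_ h3
    rw [Fintype.card_prod, Fintype.card_prod, Fintype.card_prod, Fintype.card_fun, hcardBV]
    simp only [Fintype.card_fin]
    have hgb : g₀ * b ≤ m := by
      refine le_trans ?_ hbm
      rw [one_mul]
      have := Nat.le_mul_of_pos_right (g₀ * b) (show 0 < 80 * φ by omega)
      omega
    have hgm : g₀ ≤ m := (Nat.le_mul_of_pos_right _ hb).trans hgb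
    have c1 : (2 ^ w) ^ (d + e) ≤ 2 ^ (2 * S) := by
      rw [← pow_mul, mul_comm, add_mul]
      exact Nat.pow_le_pow_right (by norm_num) (by omega)
    have c2 : a.program.length + 1 ≤ 2 ^ (C * S + 1) := by
      have p1 : m ^ C ≤ 2 ^ (C * S) := by
        calc m ^ C ≤ (2 ^ w) ^ C := Nat.pow_le_pow_left hmw.le _
          _ = 2 ^ (C * w) := by rw [← pow_mul, mul_comm]
          _ ≤ 2 ^ (C * S) := Nat.pow_le_pow_right (by norm_num) (Nat.mul_le_mul_left _ hwS)
      have p2 := hA a ha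
      have p3 : 1 ≤ 2 ^ (C * S) := Nat.one_le_two_pow
      rw [pow_succ]; omega
    have hmS : m < 2 ^ S := hmw.trans_le (Nat.pow_le_pow_right (by norm_num) hwS)
    have c3 : n / K ≤ 2 ^ (2 * S + 1) := by
      calc n / K ≤ 2 * g₀ * m := by
            apply Nat.div_le_of_le_mul
            calc n ≤ z * m := hnz
              _ ≤ 2 * (K * g₀) * m := Nat.mul_le_mul_right _ h2
              _ = _ := by ring
        _ ≤ 2 * 2 ^ S * 2 ^ S := by gcongr; exact hgm.trans hmS.le
        _ = _ := by ring
    have c4 : g₀ * b / 16 + 1 ≤ 2 ^ S := by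
      have := Nat.div_le_self (g₀ * b) 16
      omega
    -- The factors count memory contents, instruction addresses, positions in the period and
    -- remaining lengths. The two extra bits are absorbed by S ≥ 1.
    calc _ ≤ 2 ^ (2 * S) * (2 ^ (C * S + 1) * (2 ^ (2 * S + 1) * 2 ^ S)) := by gcongr
      _ = 2 ^ (2 * S + (C * S + 1 + (2 * S + 1 + S))) := by simp only [← pow_add]
      _ ≤ _ := by
        apply Nat.pow_le_pow_right (by norm_num)
        rw [add_mul]; omega
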